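/- **Theorem (reiteration theorem).** Conventions. All spaces are normed spaces over $\mathbb K=\mathbb R$ or $\mathbb C$. A compatible couple $(A_0,A_1)$ consists of two normed spaces continuously and injectively embedded in a common Hausdorff topological vector space $Z$. For $t>0$ put $$K(t,f;A_0,A_1)=\inf_{f=f_0+f_1}\big(\|f_0\|_{A_0}+t\|f_1\|_{A_1}\big)\ \ (f\in A_0+A_1),\qquad J(t,f;A_0,A_1)=\max\big(\|f\|_{A_0},t\|f\|_{A_1}\big)\ \ (f\in A_0\cap A_1).$$ $\mathcal P(\mathbb R)$ is the set of measurable $q:\mathbb R\to[1,\infty)$. Such a $q$ is log-Hölder continuous at the origin if $|q(x)-q(0)|\le c/\log(e+1/|x|)$ for all $x$, and at infinity, with limit value $q_\infty\in\mathbb R$, if $|q(x)-q_\infty|\le c/\log(e+|x|)$ for all $x$, for some constant $c>0$. For $\theta\in(0,1)$ and $q\in\mathcal P(\mathbb R)$ the space $(A_0,A_1)_{\theta,q(\cdot)}$ consists of all $f\in A_0+A_1$ for which $$\|f\|_{(A_0,A_1)_{\theta,q(\cdot)}}=\inf\Big\{\lambda>0:\int_0^\infty\big(\lambda^{-1}t^{-\theta}K(t,f;A_0,A_1)\big)^{q(t)}\frac{dt}{t}\le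 1\Big\}$$ is finite. A normed space $X$ with $A_0\cap A_1\hookrightarrow X\hookrightarrow A_0+A_1$ (continuous inclusions) is of class $\mathscr C(\theta;A_0,A_1)$, $\theta\in[0,1]$, if there is a constant $C$ such that, for all $t>0$, $K(t,f;A_0,A_1)\le Ct^{\theta}\|f\|_X$ for $f\in X$ and $\|f\|_X\le Ct^{-\theta}J(t,f;A_0,A_1)$ for $f\in A_0\cap A_1$. Let $(A_0,A_1)$ be a compatible couple of normed spaces and let $q\in\mathcal P(\mathbb R)$ be log-Hölder continuous at the origin and at infinity. Let $\theta_0\ne\theta_1$, $\eta\in(0,1)$ and $\theta=(1-\eta)\theta_0+\eta\theta_1$; if $\theta_0>\theta_1$, assume moreover that $q(0)=q_\infty$. 1. Let $\theta_0,\theta_1\in[0,1]$, and let $X_0,X_1$ be complete and of class $\mathscr C(\theta_0;A_0,A_1)$ and $\mathscr C(\theta_1;A_0,A_1)$, respectively. Then $(A_0,A_1)_{\theta,q(\cdot)}=(X_0,X_1)_{\eta,q(\cdot)}$ with equivalence of norms. 2. Let $\theta_0,\theta_1\in(0,1)$, let $q_0,q_1\in\mathcal P(\mathbb R)$ be log-Hölder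 continuous at the origin and at infinity, and let $(A_0,A_1)_{\theta_0,q_0(\cdot)}$ and $(A_0,A_1)_{\theta_1,q_1(\cdot)}$ be complete. Then $$\big((A_0,A_1)_{\theta_0,q_0(\cdot)},(A_0,A_1)_{\theta_1,q_1(\cdot)}\big)_{\eta,q(\cdot)}=(A_0,A_1)_{\theta,q(\cdot)}$$ with equivalence of norms. -/

import Mathlib

open MeasureTheory Filter Topology Set
open scoped ENNReal NNReal

namespace VarInterp

/-- The class `𝒫(ℝ)` of variable exponents: measurable functions with range in `[1, ∞)`. -/
structure IsExponent (q : ℝ → ℝ) : Prop where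
  measurable : Measurable q
  one_le : ∀ x, 1 ≤ q x

/-- `q` is log-Hölder continuous at the origin
(for `x = 0` the inequality reads `0 ≤ c`, since `1 / 0 = 0`). -/
def LogHolderAtZero (q : ℝ → ℝ) : Prop :=
  ∃ c : ℝ, 0 < c ∧ ∀ x : ℝ, |q x - q 0| ≤ c / Real.log (Real.exp 1 + 1 / |x|)

/-- `q` is log-Hölder continuous at infinity, with limit value `qinf`. -/
def LogHolderAtInfty (q : ℝ → ℝ) (qinf : ℝ) : Prop :=
  ∃ c : ℝ, 0 < c ∧ ∀ x : ℝ, |q x - qinf| ≤ c / Real.log (Real.exp 1 + |x|)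

/-- The measure `dt / t` on `(0, ∞)`. -/
noncomputable def haarPos : Measure ℝ :=
  (volume.restrict (Ioi (0 : ℝ))).withDensity fun t => ENNReal.ofReal t⁻¹

/-- The variable exponent modular `∫₀^∞ F(t) ^ q(t) dt / t` of a nonnegative function. -/
noncomputable def modular (q : ℝ → ℝ) (F : ℝ → ℝ≥0∞) : ℝ≥0∞ :=
  ∫⁻ t, F t ^ q t ∂haarPos

/-- The Luxemburg norm in `L^{q(·)}((0, ∞), dt / t)` of a nonnegative function
(equal to `∞` when the function does not belong to the space). -/
noncomputable def luxemburgNorm (q : ℝ → ℝ) (F : ℝ → ℝ≥0∞) : ℝ≥0∞ :=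
  ⨅ (l : ℝ≥0) (_ : 0 < l) (_ : modular q (fun t => F t / (l : ℝ≥0∞)) ≤ 1), (l : ℝ≥0∞)

section Spaces

variable {Z : Type*}

/-! A normed space `A` contained in the ambient space `Z` is encoded by its extended norm
`N : Z → [0, ∞]`, which is the norm of `A` on `A` and `∞` off `A`; thus `A = {f | N f < ∞}`. -/

/-- The extended norm on `Z` of a normed space `A` embedded into `Z` by `ι`. -/
noncomputable def embNorm {A : Type*} [NormedAddCommGroup A] (ι : A → Z) (f : Z) : ℝ≥0∞ :=
  ⨅ (a : A) (_ : ι a = f), ‖a‖ₑ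

/-- The `K`-functional: `K(t, f) = inf {‖f₀‖_{A₀} + t ‖f₁‖_{A₁} : f = f₀ + f₁}`;
it is finite exactly when `f ∈ A₀ + A₁`. -/
noncomputable def KFun [Add Z] (N₀ N₁ : Z → ℝ≥0∞) (t : ℝ) (f : Z) : ℝ≥0∞ :=
  ⨅ (f₀ : Z) (f₁ : Z) (_ : f = f₀ + f₁), (N₀ f₀ + ENNReal.ofReal t * N₁ f₁)

/-- The `J`-functional: `J(t, f) = max (‖f‖_{A₀}, t ‖f‖_{A₁})`;
it is finite exactly when `f ∈ A₀ ∩ A₁`. -/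
noncomputable def JFun (N₀ N₁ : Z → ℝ≥0∞) (t : ℝ) (f : Z) : ℝ≥0∞ :=
  max (N₀ f) (ENNReal.ofReal t * N₁ f)

/-- The (extended) norm of the real interpolation space `(A₀, A₁)_{θ, q(·)}`, that is
`‖t ^ (-θ) K(t, f)‖` in `L^{q(·)}((0, ∞), dt / t)`. The space consists of all `f` for which
it is finite. -/
noncomputable def interpNorm [Add Z] (N₀ N₁ : Z → ℝ≥0∞) (θ : ℝ) (q : ℝ → ℝ) (f : Z) : ℝ≥0∞ :=
  luxemburgNorm q fun t => ENNReal.ofReal (t ^ (-θ)) * KFun N₀ N₁ t f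

/-- `X` is an intermediate space with respect to `(A₀, A₁)`:
`A₀ ∩ A₁ ⊆ X ⊆ A₀ + A₁` with continuous inclusions. -/
def IsIntermediate [Add Z] (N₀ N₁ NX : Z → ℝ≥0∞) : Prop :=
  (∃ C : ℝ≥0, ∀ f, JFun N₀ N₁ 1 f < ⊤ → NX f ≤ C * JFun N₀ N₁ 1 f) ∧
  (∃ C : ℝ≥0, ∀ f, NX f < ⊤ → KFun N₀ N₁ 1 f ≤ C * NX f)

/-- `X` is of class `𝒞_K(θ; A₀, A₁)`. -/
def IsClassK [Add Z] (θ : ℝ) (N₀ N₁ NX : Z → ℝ≥0∞) : Prop :=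
  ∃ C : ℝ≥0, ∀ t : ℝ, 0 < t → ∀ f, NX f < ⊤ →
    KFun N₀ N₁ t f ≤ C * ENNReal.ofReal (t ^ θ) * NX f

/-- `X` is of class `𝒞_J(θ; A₀, A₁)`. -/
def IsClassJ (θ : ℝ) (N₀ N₁ NX : Z → ℝ≥0∞) : Prop :=
  ∃ C : ℝ≥0, ∀ t : ℝ, 0 < t → ∀ f, N₀ f < ⊤ → N₁ f < ⊤ →
    NX f ≤ C * ENNReal.ofReal (t ^ (-θ)) * JFun N₀ N₁ t f

/-- The intermediate space `X` is of class `𝒞(θ; A₀, A₁)`. -/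
structure IsClass [Add Z] (θ : ℝ) (N₀ N₁ NX : Z → ℝ≥0∞) : Prop where
  intermediate : IsIntermediate N₀ N₁ NX
  classK : IsClassK θ N₀ N₁ NX
  classJ : IsClassJ θ N₀ N₁ NX

/-- The space `{f | N f < ∞}` is complete for the norm `N`. -/
def IsCompleteFor [Sub Z] (N : Z → ℝ≥0∞) : Prop :=
  ∀ u : ℕ → Z, (∀ n, N (u n) < ⊤) →
    (∀ ε : ℝ≥0∞, 0 < ε → ∃ M : ℕ, ∀ m ≥ M, ∀ n ≥ M, N (u m - u n) < ε) →
    ∃ f : Z, N f < ⊤ ∧ Tendsto (fun n => N (u n - f)) atTop (𝓝 0)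

/-- The spaces `{f | N f < ∞}` and `{f | M f < ∞}` coincide, with equivalent norms. -/
def SameSpace (N M : Z → ℝ≥0∞) : Prop :=
  {f | N f < ⊤} = {f | M f < ⊤} ∧
  ∃ c C : ℝ≥0, 0 < c ∧ 0 < C ∧ ∀ f, N f < ⊤ → c * N f ≤ M f ∧ M f ≤ C * N f

end Spaces

end VarInterp

/-!
Reiteration for real interpolation with a variable exponent `q` that is log-Hölder continuous at
`0` and at `∞`.

**Freezing the exponent.** For quasiconcave `φ`, such as `t ↦ K(t, f)`, the norm of `t ^ (-θ) φ t`
in `L^{q(·)}(dt / t)` is equivalent to the Luxemburg norm of the samples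
`2 ^ (-θ d k) φ (2 ^ (d k))`, `k ∈ ℤ`, for the exponent sequence equal to `q 0` for `k < 0` and to
`q_∞` for `k ≥ 0` (`exists_seqNorm_samples_le`, `exists_luxemburgNorm_le_samples`). The step `d > 0`
is arbitrary. On `[2 ^ (d k), 2 ^ (d (k + 1)))` the exponent differs from its limit by
`O(1 / |k|)`, so for `x ≤ 1` the two powers of `x` are comparable up to a summable error
`2 ^ (-d |k|)` (`exists_rpow_compare`); modulars at most `1` bound the samples, which reduces
everything to `x ≤ 1`. A change of variables `t ↦ t ^ (θ₁ - θ₀)` now only changes the step `d`, and,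
if `θ₁ < θ₀`, reverses the sequence, which is harmless when `q 0 = q_∞`.

**From `X` to `A`.** Class `𝒞_K` gives
`K(t, f; A₀, A₁) ≤ C t ^ θ₀ K(t ^ (θ₁ - θ₀), f; X₀, X₁)` (`exists_KFun_le_KFun`), hence a pointwise
bound between samples.

**From `A` to `X`.** Near-optimal decompositions `f = g k + h k` at the scales `2 ^ k` have
increments `u k = g (k + 1) - g k` with `J(2 ^ k, u k) ≤ 6 K(2 ^ k, f)`
(`exists_dyadic_decomposition`), and class `𝒞_J` bounds them in `X₀` and `X₁`. Completeness of the
`X_i` makes `g m` and `h m` the sums of their increments in `X₀` and `X₁`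
(`le_tsum_sub_of_complete`), so the samples of `K(t, f; X₀, X₁)` are dominated by the convolution of
those of `K(t, f; A₀, A₁)` with a geometric weight (`samples_le_tsum_decay`). Such convolutions are
bounded for the Luxemburg norm (`exists_seqNorm_conv_le`).

The second assertion follows from the first, because `(A₀, A₁)_{θ_i, q_i(·)}` is of class
`𝒞(θ_i; A₀, A₁)` (`isClass_interpNorm`). Normed spaces enter only through extended norms on the
ambient group (`IsExtNorm`), so the argument applies to both assertions at once.
-/

namespace VarInterp

/-! ### Extended norms and the `K`-functional -/

/-- An extended norm on an additive group: vanishing at `0`, subadditive and even.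
Neither definiteness nor homogeneity is part of the definition. -/
structure IsExtNorm {Z : Type*} [AddCommGroup Z] (N : Z → ℝ≥0∞) : Prop where
  map_zero : N 0 = 0
  add_le : ∀ f g, N (f + g) ≤ N f + N g
  map_neg : ∀ f, N (-f) = N f

section KFunctional

variable {Z : Type*} [AddCommGroup Z] {N N₀ N₁ X₀ X₁ : Z → ℝ≥0∞}

theorem IsExtNorm.sub_le (h : IsExtNorm N) (f g : Z) : N (f - g) ≤ N f + N g := by
  rw [sub_eq_add_neg]
  exact (h.add_le _ _).trans_eq (by rw [h.map_neg])

theorem IsExtNorm.map_sub_comm (h : IsExtNorm N) (f g : Z) : N (f - g) = N (g - f) := by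
  rw [← neg_sub, h.map_neg]

theorem KFun_le (t : ℝ) {f f₀ f₁ : Z} (h : f = f₀ + f₁) :
    KFun N₀ N₁ t f ≤ N₀ f₀ + ENNReal.ofReal t * N₁ f₁ :=
  iInf₂_le_of_le f₀ f₁ (iInf_le _ h)

theorem le_KFun {t : ℝ} {f : Z} {c : ℝ≥0∞}
    (h : ∀ f₀ f₁, f = f₀ + f₁ → c ≤ N₀ f₀ + ENNReal.ofReal t * N₁ f₁) : c ≤ KFun N₀ N₁ t f :=
  le_iInf₂ fun f₀ f₁ => le_iInf fun hf => h f₀ f₁ hf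

theorem exists_of_KFun_lt {t : ℝ} {f : Z} {c : ℝ≥0∞} (h : KFun N₀ N₁ t f < c) :
    ∃ f₀ f₁, f = f₀ + f₁ ∧ N₀ f₀ + ENNReal.ofReal t * N₁ f₁ < c := by
  simpa only [KFun, iInf_lt_iff, exists_prop] using h

theorem KFun_mono (f : Z) : Monotone fun t => KFun N₀ N₁ t f := fun s t hst =>
  le_KFun fun f₀ f₁ hf => (KFun_le s hf).trans (by gcongr)

theorem KFun_mul_le {s : ℝ} (hs : 1 ≤ s) (t : ℝ) (f : Z) :
    KFun N₀ N₁ (s * t) f ≤ ENNReal.ofReal s * KFun N₀ N₁ t f := by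
  have h0 : ENNReal.ofReal s ≠ 0 := by simpa using lt_of_lt_of_le one_pos hs
  rw [mul_comm (ENNReal.ofReal s),
    ← ENNReal.div_le_iff_le_mul (Or.inl h0) (Or.inl ENNReal.ofReal_ne_top)]
  refine le_KFun fun f₀ f₁ hf => ?_
  rw [ENNReal.div_le_iff_le_mul (Or.inl h0) (Or.inl ENNReal.ofReal_ne_top),
    mul_comm _ (ENNReal.ofReal s), mul_add, ← mul_assoc, ← ENNReal.ofReal_mul (by linarith)]
  refine (KFun_le _ hf).trans (add_le_add_left ?_ _)
  exact le_mul_of_one_le_left zero_le (by simpa using ENNReal.ofReal_le_ofReal hs)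

theorem KFun_le_left (h₁ : IsExtNorm N₁) (t : ℝ) (f : Z) : KFun N₀ N₁ t f ≤ N₀ f :=
  (KFun_le t (add_zero f).symm).trans_eq (by simp [h₁.map_zero])

theorem KFun_le_right (h₀ : IsExtNorm N₀) (t : ℝ) (f : Z) :
    KFun N₀ N₁ t f ≤ ENNReal.ofReal t * N₁ f :=
  (KFun_le t (zero_add f).symm).trans_eq (by simp [h₀.map_zero])

theorem isExtNorm_KFun (h₀ : IsExtNorm N₀) (h₁ : IsExtNorm N₁) (t : ℝ) :
    IsExtNorm (KFun N₀ N₁ t) where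
  map_zero := by simpa [h₀.map_zero] using KFun_le_left (N₀ := N₀) h₁ t 0
  add_le f g := by
    conv_rhs => simp only [KFun, ENNReal.iInf_add, ENNReal.add_iInf]
    refine le_iInf₂ fun f₀ f₁ => le_iInf fun hf => le_iInf₂ fun g₀ g₁ => le_iInf fun hg => ?_
    refine (KFun_le t (f₀ := f₀ + g₀) (f₁ := f₁ + g₁) (by rw [hf, hg]; abel)).trans ?_
    calc N₀ (f₀ + g₀) + ENNReal.ofReal t * N₁ (f₁ + g₁)
        ≤ (N₀ f₀ + N₀ g₀) + ENNReal.ofReal t * (N₁ f₁ + N₁ g₁) := by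
          gcongr
          exacts [h₀.add_le _ _, h₁.add_le _ _]
      _ = _ := by ring
  map_neg := by
    have key : ∀ f, KFun N₀ N₁ t (-f) ≤ KFun N₀ N₁ t f := fun f =>
      le_KFun fun f₀ f₁ hf => (KFun_le t (f₀ := -f₀) (f₁ := -f₁) (by rw [hf]; abel)).trans_eq
        (by rw [h₀.map_neg, h₁.map_neg])
    exact fun f => le_antisymm (key f) (by simpa using key (-f))

/-- If `K(1, ·)` is definite, so is `K(t, ·)` for every `t > 0`. -/
theorem eq_zero_of_KFun_eq_zero (hsep : ∀ f, KFun N₀ N₁ 1 f = 0 → f = 0) {t : ℝ} (ht : 0 < t)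
    {f : Z} (h : KFun N₀ N₁ t f = 0) : f = 0 := by
  refine hsep f (le_antisymm ?_ zero_le)
  calc KFun N₀ N₁ 1 f ≤ KFun N₀ N₁ (max 1 t⁻¹ * t) f := KFun_mono f <| by
        rw [max_mul_of_nonneg _ _ ht.le, inv_mul_cancel₀ ht.ne']
        exact le_max_right _ _
    _ ≤ _ := KFun_mul_le (le_max_left _ _) _ _
    _ = 0 := by rw [h, mul_zero]

/-- An almost optimal decomposition for the `K`-functional. The degenerate case `K(t, f) = 0` is
covered because then `f = 0`. -/
theorem exists_add_le_two_mul_KFun (h₀ : IsExtNorm N₀) (h₁ : IsExtNorm N₁)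
    (hsep : ∀ f, KFun N₀ N₁ 1 f = 0 → f = 0) {t : ℝ} (ht : 0 < t) {f : Z}
    (hf : KFun N₀ N₁ t f ≠ ⊤) :
    ∃ f₀ f₁, f = f₀ + f₁ ∧ N₀ f₀ + ENNReal.ofReal t * N₁ f₁ ≤ 2 * KFun N₀ N₁ t f := by
  rcases eq_or_ne (KFun N₀ N₁ t f) 0 with h | h
  · refine ⟨0, 0, ?_, ?_⟩
    · rw [eq_zero_of_KFun_eq_zero hsep ht h, add_zero]
    · simp [h₀.map_zero, h₁.map_zero]
  · have : KFun N₀ N₁ t f < 2 * KFun N₀ N₁ t f := by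
      rw [two_mul]
      exact ENNReal.lt_add_right hf h
    obtain ⟨f₀, f₁, e, hlt⟩ := exists_of_KFun_lt this
    exact ⟨f₀, f₁, e, hlt.le⟩

/-- Absolutely convergent telescoping series in a complete space `X ⊆ A₀ + A₁`: if `v n → 0`
in `A₀ + A₁`, then `v 0` is the sum of the increments `v n - v (n + 1)`. -/
theorem le_tsum_sub_of_complete (h₀ : IsExtNorm N₀) (h₁ : IsExtNorm N₁)
    (hsep : ∀ f, KFun N₀ N₁ 1 f = 0 → f = 0)
    (hX : IsExtNorm N) (hc : IsCompleteFor N)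
    (hK : ∃ C : ℝ≥0, ∀ f, N f < ⊤ → KFun N₀ N₁ 1 f ≤ C * N f)
    (v : ℕ → Z) (hv : Tendsto (fun n => KFun N₀ N₁ 1 (v n)) atTop (𝓝 0)) :
    N (v 0) ≤ ∑' n, N (v n - v (n + 1)) := by
  set S := ∑' n, N (v n - v (n + 1)) with hS
  rcases eq_or_ne S ⊤ with htop | htop
  · rw [htop]; exact le_top
  -- the tail of the series bounds the increments of the partial sums
  have htele : ∀ m n, N (v m - v (m + n)) ≤
      ∑ i ∈ Finset.range n, N (v (m + i) - v (m + i + 1)) := by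
    intro m n
    induction n with
    | zero => simp [hX.map_zero]
    | succ n ih =>
      rw [Finset.sum_range_succ]
      calc N (v m - v (m + (n + 1)))
          = N ((v m - v (m + n)) + (v (m + n) - v (m + n + 1))) := by
            rw [sub_add_sub_cancel, add_assoc]
        _ ≤ _ := (hX.add_le _ _).trans (add_le_add_left ih _)
  have htail : Tendsto (fun m => ∑' i, N (v (i + m) - v (i + m + 1))) atTop (𝓝 0) :=
    ENNReal.tendsto_sum_nat_add (fun n => N (v n - v (n + 1))) htop
  have htele' : ∀ m n, N (v m - v (m + n)) ≤ ∑' i, N (v (i + m) - v (i + m + 1)) := fun m n =>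
    (htele m n).trans <|
      (ENNReal.sum_le_tsum (f := fun i => N (v (m + i) - v (m + i + 1))) _).trans_eq
        (by simp only [add_comm m])
  have hbound : ∀ n, N (v 0 - v n) ≤ S := fun n => by simpa using htele' 0 n
  obtain ⟨w, hw, hlim⟩ := hc (fun n => v 0 - v n) (fun n => (hbound n).trans_lt htop.lt_top) <| by
    intro ε hε
    obtain ⟨M, hM⟩ := (eventually_atTop.1 ((tendsto_order.1 htail).2 ε hε))
    have aux : ∀ m ≥ M, ∀ n, m ≤ n → N ((v 0 - v m) - (v 0 - v n)) < ε := by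
      intro m hm n hmn
      obtain ⟨k, rfl⟩ := Nat.exists_eq_add_of_le hmn
      rw [sub_sub_sub_cancel_left, hX.map_sub_comm]
      exact (htele' m k).trans_lt (hM m hm)
    refine ⟨M, fun m hm n hn => ?_⟩
    rcases le_total m n with h | h
    · exact aux m hm n h
    · rw [hX.map_sub_comm]; exact aux n hn m h
  obtain ⟨C, hC⟩ := hK
  have hKn := isExtNorm_KFun h₀ h₁ 1
  have hzero : KFun N₀ N₁ 1 (v 0 - w) = 0 := by
    have hle : ∀ n, KFun N₀ N₁ 1 (v 0 - w) ≤ C * N (v 0 - v n - w) + KFun N₀ N₁ 1 (v n) := by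
      intro n
      have hfin : N (v 0 - v n - w) < ⊤ :=
        (hX.sub_le _ _).trans_lt (ENNReal.add_lt_top.2 ⟨(hbound n).trans_lt htop.lt_top, hw⟩)
      calc KFun N₀ N₁ 1 (v 0 - w) = KFun N₀ N₁ 1 ((v 0 - v n - w) + v n) := by congr 1; abel
        _ ≤ _ := (hKn.add_le _ _).trans (add_le_add_left (hC _ hfin) _)
    have hl : Tendsto (fun n => C * N (v 0 - v n - w) + KFun N₀ N₁ 1 (v n)) atTop (𝓝 0) := by
      have := (ENNReal.Tendsto.const_mul hlim (Or.inr (ENNReal.coe_ne_top (r := C)))).add hv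
      simpa using this
    exact le_antisymm (ge_of_tendsto' hl hle) zero_le
  have hvw : v 0 = w := sub_eq_zero.1 (hsep _ hzero)
  have hle : ∀ n, N (v 0) ≤ N (v 0 - v n - w) + S := by
    intro n
    calc N (v 0) = N (-(v 0 - v n - w) + (v 0 - v n)) := by
          rw [← hvw]; congr 1; abel
      _ ≤ _ := (hX.add_le _ _).trans (by rw [hX.map_neg]; gcongr; exact hbound n)
  have hl : Tendsto (fun n => N (v 0 - v n - w) + S) atTop (𝓝 S) := by
    simpa using hlim.add_const S
  exact ge_of_tendsto' hl hle

end KFunctional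

section Embedded

section

variable {Z A : Type*} [NormedAddCommGroup A]

theorem embNorm_apply_le (ι : A → Z) (a : A) : embNorm ι (ι a) ≤ ‖a‖ₑ :=
  iInf_le_of_le a (iInf_le _ rfl)

theorem exists_of_embNorm_lt {ι : A → Z} {f : Z} {c : ℝ≥0∞} (h : embNorm ι f < c) :
    ∃ a, ι a = f ∧ ‖a‖ₑ < c := by
  simpa only [embNorm, iInf_lt_iff, exists_prop] using h

theorem embNorm_apply {ι : A → Z} (hι : Function.Injective ι) (a : A) :
    embNorm ι (ι a) = ‖a‖ₑ := by
  refine le_antisymm (embNorm_apply_le ι a) (le_iInf₂ fun b hb => ?_)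
  rw [hι hb]

end

variable {𝕜 : Type*} [RCLike 𝕜] {Z : Type*} [AddCommGroup Z] [Module 𝕜 Z] [TopologicalSpace Z]
  {A : Type*} [NormedAddCommGroup A] [NormedSpace 𝕜 A]

theorem isExtNorm_embNorm (ι : A →L[𝕜] Z) : IsExtNorm (embNorm ι) where
  map_zero := by simpa using embNorm_apply_le ι 0
  add_le f g := by
    conv_rhs => simp only [embNorm, ENNReal.iInf_add, ENNReal.add_iInf]
    refine le_iInf₂ fun b hb => le_iInf₂ fun a ha => ?_
    rw [← ha, ← hb, ← map_add]
    exact (embNorm_apply_le ι _).trans (enorm_add_le a b)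
  map_neg := by
    have key : ∀ f, embNorm ι (-f) ≤ embNorm ι f := fun f => le_iInf₂ fun a ha => by
      rw [← ha, ← map_neg, ← enorm_neg a]
      exact embNorm_apply_le ι _
    exact fun f => le_antisymm (key f) (by simpa using key (-f))

theorem isCompleteFor_embNorm [CompleteSpace A] (ι : A →L[𝕜] Z) (hι : Function.Injective ι) :
    IsCompleteFor (embNorm ι) := by
  intro u hu hcau
  choose v hv _ using fun n => exists_of_embNorm_lt (hu n)
  have hcs : CauchySeq v := by
    rw [EMetric.cauchySeq_iff]
    intro ε hε
    obtain ⟨M, hM⟩ := hcau ε hε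
    refine ⟨M, fun m hm n hn => ?_⟩
    have := hM m hm n hn
    rwa [← hv, ← hv, ← map_sub, embNorm_apply hι, ← edist_eq_enorm_sub] at this
  obtain ⟨a, ha⟩ := cauchySeq_tendsto_of_complete hcs
  refine ⟨ι a, (embNorm_apply_le ι a).trans_lt enorm_lt_top, ?_⟩
  have : ∀ n, embNorm ι (u n - ι a) = edist (v n) a := fun n => by
    rw [← hv, ← map_sub, embNorm_apply hι, ← edist_eq_enorm_sub]
  simp only [this]
  exact tendsto_iff_edist_tendsto_0.1 ha

/-- In a compatible couple `K(1, ·)` is definite, since the ambient space is Hausdorff. -/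
theorem eq_zero_of_KFun_embNorm [IsTopologicalAddGroup Z] [T2Space Z]
    {B : Type*} [NormedAddCommGroup B] [NormedSpace 𝕜 B] (a : A →L[𝕜] Z) (b : B →L[𝕜] Z) (f : Z)
    (h : KFun (embNorm a) (embNorm b) 1 f = 0) : f = 0 := by
  have hex : ∀ n : ℕ, ∃ x : A, ∃ y : B, f = a x + b y ∧ ‖x‖ₑ < ((n : ℝ≥0∞))⁻¹ ∧
      ‖y‖ₑ < ((n : ℝ≥0∞))⁻¹ := by
    intro n
    have hn : KFun (embNorm a) (embNorm b) 1 f < ((n : ℝ≥0∞))⁻¹ := by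
      rw [h]; exact ENNReal.inv_pos.2 (ENNReal.natCast_ne_top n)
    obtain ⟨f₀, f₁, e, hlt⟩ := exists_of_KFun_lt hn
    rw [ENNReal.ofReal_one, one_mul] at hlt
    obtain ⟨x, hx, hx'⟩ := exists_of_embNorm_lt (lt_of_le_of_lt le_self_add hlt)
    obtain ⟨y, hy, hy'⟩ := exists_of_embNorm_lt (lt_of_le_of_lt le_add_self hlt)
    exact ⟨x, y, by rw [e, hx, hy], hx', hy'⟩
  choose x y hxy hx hy using hex
  have hx0 : Tendsto x atTop (𝓝 0) := by
    rw [tendsto_iff_edist_tendsto_0]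
    simp only [edist_zero_right]
    exact tendsto_of_tendsto_of_tendsto_of_le_of_le tendsto_const_nhds
      ENNReal.tendsto_inv_nat_nhds_zero (fun _ => zero_le) fun n => (hx n).le
  have hy0 : Tendsto y atTop (𝓝 0) := by
    rw [tendsto_iff_edist_tendsto_0]
    simp only [edist_zero_right]
    exact tendsto_of_tendsto_of_tendsto_of_le_of_le tendsto_const_nhds
      ENNReal.tendsto_inv_nat_nhds_zero (fun _ => zero_le) fun n => (hy n).le
  have hlim : Tendsto (fun n => a (x n) + b (y n)) atTop (𝓝 (a 0 + b 0)) :=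
    ((a.continuous.tendsto 0).comp hx0).add ((b.continuous.tendsto 0).comp hy0)
  simp only [← hxy, map_zero, add_zero] at hlim
  exact tendsto_nhds_unique tendsto_const_nhds hlim

end Embedded

/-! ### Luxemburg functionals of modulars -/

section Modular

variable {α β : Type*}

/-- The Luxemburg functional `inf {l > 0 : ρ (F / l) ≤ 1}` of a modular `ρ`. -/
noncomputable def modNorm (ρ : (α → ℝ≥0∞) → ℝ≥0∞) (F : α → ℝ≥0∞) : ℝ≥0∞ :=
  ⨅ (l : ℝ≥0) (_ : 0 < l) (_ : ρ (fun x => F x / (l : ℝ≥0∞)) ≤ 1), (l : ℝ≥0∞)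

theorem luxemburgNorm_eq_modNorm (q : ℝ → ℝ) (F : ℝ → ℝ≥0∞) :
    luxemburgNorm q F = modNorm (modular q) F := rfl

theorem modNorm_le {ρ : (α → ℝ≥0∞) → ℝ≥0∞} {F : α → ℝ≥0∞} {l : ℝ≥0} (hl : 0 < l)
    (h : ρ (fun x => F x / (l : ℝ≥0∞)) ≤ 1) : modNorm ρ F ≤ l :=
  iInf₂_le_of_le l hl (iInf_le _ h)

theorem le_modNorm {ρ : (α → ℝ≥0∞) → ℝ≥0∞} {F : α → ℝ≥0∞} {c : ℝ≥0∞}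
    (h : ∀ l : ℝ≥0, 0 < l → ρ (fun x => F x / (l : ℝ≥0∞)) ≤ 1 → c ≤ l) : c ≤ modNorm ρ F :=
  le_iInf fun l => le_iInf₂ fun hl hρ => h l hl hρ

/-- A bound between unit balls of modulars is a bound between their Luxemburg functionals. -/
theorem modNorm_le_mul {ρ : (α → ℝ≥0∞) → ℝ≥0∞} {σ : (β → ℝ≥0∞) → ℝ≥0∞} {F : α → ℝ≥0∞}
    {G : β → ℝ≥0∞} {M : ℝ≥0} (hM : 0 < M)
    (h : ∀ l : ℝ≥0, 0 < l → ρ (fun x => F x / (l : ℝ≥0∞)) ≤ 1 →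
      σ (fun x => G x / (l : ℝ≥0∞) / (M : ℝ≥0∞)) ≤ 1) :
    modNorm σ G ≤ M * modNorm ρ F := by
  have hM0 : (M : ℝ≥0∞) ≠ 0 := by exact_mod_cast hM.ne'
  rw [mul_comm, ← ENNReal.div_le_iff_le_mul (Or.inl hM0) (Or.inl ENNReal.coe_ne_top)]
  refine le_modNorm fun l hl hF => ?_
  rw [ENNReal.div_le_iff_le_mul (Or.inl hM0) (Or.inl ENNReal.coe_ne_top), ← ENNReal.coe_mul]
  refine modNorm_le (mul_pos hl hM) ?_
  have hl0 : (l : ℝ≥0∞) ≠ 0 := by exact_mod_cast hl.ne'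
  have e : ∀ y : ℝ≥0∞, y / ((l * M : ℝ≥0) : ℝ≥0∞) = y / l / M := fun y => by
    rw [ENNReal.coe_mul, div_eq_mul_inv, ENNReal.mul_inv (Or.inl hl0) (Or.inr hM0), ← mul_assoc,
      div_eq_mul_inv, div_eq_mul_inv]
  simpa only [e] using h l hl hF

/-- The modular `∑ k, a k ^ p k` of a two-sided sequence. -/
noncomputable def seqModular (p : ℤ → ℝ) (a : ℤ → ℝ≥0∞) : ℝ≥0∞ := ∑' k, a k ^ p k

/-- The Luxemburg norm of the variable exponent sequence space `ℓ^{p(·)}(ℤ)`. -/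
noncomputable def seqNorm (p : ℤ → ℝ) (a : ℤ → ℝ≥0∞) : ℝ≥0∞ := modNorm (seqModular p) a

theorem div_div_le_div_of_le_mul {x y l C : ℝ≥0∞} (h : x ≤ C * y) : x / l / C ≤ y / l := by
  refine ENNReal.div_le_of_le_mul ?_
  calc x / l ≤ C * y / l := ENNReal.div_le_div_right h _
    _ = y / l * C := by rw [div_eq_mul_inv, div_eq_mul_inv]; ring

theorem div_rpow_le_div {M x : ℝ≥0∞} (hM : 1 ≤ M) {p : ℝ} (hp : 1 ≤ p) :
    (x / M) ^ p ≤ x ^ p / M := by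
  rw [ENNReal.div_rpow_of_nonneg _ _ (by linarith)]
  exact ENNReal.div_le_div_left (ENNReal.le_rpow_self_of_one_le hM hp) _

theorem seqModular_div_le_one {p : ℤ → ℝ} (hp : ∀ k, 1 ≤ p k) {a : ℤ → ℝ≥0∞} {M : ℝ≥0∞}
    (hM : 1 ≤ M) (h : seqModular p a ≤ M) : seqModular p (fun k => a k / M) ≤ 1 := by
  calc seqModular p (fun k => a k / M) ≤ ∑' k, a k ^ p k / M :=
        ENNReal.tsum_le_tsum fun k => div_rpow_le_div hM (hp k)
    _ = seqModular p a / M := by simp only [div_eq_mul_inv, ENNReal.tsum_mul_right, seqModular]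
    _ ≤ 1 := ENNReal.div_le_of_le_mul (by rwa [one_mul])

theorem modular_div_le_one {q : ℝ → ℝ} (hq : ∀ x, 1 ≤ q x) {F : ℝ → ℝ≥0∞} {M : ℝ≥0∞}
    (hM : 1 ≤ M) (h : modular q F ≤ M) : modular q (fun t => F t / M) ≤ 1 := by
  calc modular q (fun t => F t / M) ≤ ∫⁻ t, F t ^ q t / M ∂haarPos :=
        lintegral_mono fun t => div_rpow_le_div hM (hq t)
    _ = modular q F / M := by
        simp only [div_eq_mul_inv]
        exact lintegral_mul_const' _ _ (ENNReal.inv_ne_top.2 (one_pos.trans_le hM).ne')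
    _ ≤ 1 := ENNReal.div_le_of_le_mul (by rwa [one_mul])

theorem seqModular_mono {p : ℤ → ℝ} (hp : ∀ k, 1 ≤ p k) {a b : ℤ → ℝ≥0∞} (h : ∀ k, a k ≤ b k) :
    seqModular p a ≤ seqModular p b :=
  ENNReal.tsum_le_tsum fun k => ENNReal.rpow_le_rpow (h k) (by linarith [hp k])

theorem seqNorm_le_mul_of_le {p : ℤ → ℝ} (hp : ∀ k, 1 ≤ p k) {a b : ℤ → ℝ≥0∞} {C : ℝ≥0}
    (hC : 0 < C) (h : ∀ k, a k ≤ C * b k) : seqNorm p a ≤ C * seqNorm p b := by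
  refine modNorm_le_mul hC fun l hl hb => (seqModular_mono hp fun k => ?_).trans hb
  exact div_div_le_div_of_le_mul (h k)

theorem le_one_of_seqModular_le_one {p : ℤ → ℝ} (hp : ∀ k, 1 ≤ p k) {a : ℤ → ℝ≥0∞}
    (h : seqModular p a ≤ 1) (k : ℤ) : a k ≤ 1 := by
  by_contra! hcon
  exact absurd ((ENNReal.le_tsum k).trans h)
    (not_le.2 (ENNReal.one_lt_rpow hcon (by linarith [hp k])))

/-- Each term of a sequence is bounded by its Luxemburg norm. -/
theorem le_seqNorm {p : ℤ → ℝ} (hp : ∀ k, 1 ≤ p k) (a : ℤ → ℝ≥0∞) (k : ℤ) :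
    a k ≤ seqNorm p a := by
  refine le_modNorm fun l hl h => ?_
  have hl0 : (l : ℝ≥0∞) ≠ 0 := by exact_mod_cast hl.ne'
  have h2 : a k / l ≤ 1 := le_one_of_seqModular_le_one hp h k
  simpa using (ENNReal.div_le_iff_le_mul (Or.inl hl0) (Or.inl ENNReal.coe_ne_top)).1 h2

theorem seqNorm_comp_equiv {p : ℤ → ℝ} (e : ℤ ≃ ℤ) (hp : ∀ k, p (e k) = p k)
    (a : ℤ → ℝ≥0∞) : seqNorm p (fun k => a (e k)) = seqNorm p a := by
  have : ∀ b : ℤ → ℝ≥0∞, seqModular p (fun k => b (e k)) = seqModular p b := fun b => by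
    rw [seqModular, seqModular, ← e.tsum_eq fun k => b k ^ p k]
    simp only [hp]
  simp only [seqNorm, modNorm]
  congr! 5 with l hl
  exact this fun k => a k / l

end Modular

/-! ### A Hardy inequality for sequences -/

/-- The two-sided geometric weight `2 ^ (-ε |k|)`. -/
noncomputable def decay (ε : ℝ) (k : ℤ) : ℝ≥0∞ := 2 ^ (-(ε * |(k : ℝ)|))

/-- The exponent sequence equal to `u` on the negative and `v` on the nonnegative integers. -/
def signExp (u v : ℝ) (k : ℤ) : ℝ := if k < 0 then u else v

theorem one_le_signExp {u v : ℝ} (hu : 1 ≤ u) (hv : 1 ≤ v) (k : ℤ) : 1 ≤ signExp u v k := by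
  unfold signExp; split_ifs <;> assumption

theorem two_rpow_mono {x y : ℝ} (h : x ≤ y) : (2 : ℝ≥0∞) ^ x ≤ 2 ^ y :=
  ENNReal.rpow_le_rpow_of_exponent_le one_le_two h

theorem two_rpow_add (x y : ℝ) : (2 : ℝ≥0∞) ^ (x + y) = 2 ^ x * 2 ^ y :=
  ENNReal.rpow_add _ _ two_ne_zero ENNReal.ofNat_ne_top

theorem two_rpow_ne_zero (x : ℝ) : (2 : ℝ≥0∞) ^ x ≠ 0 := by simp

theorem two_rpow_ne_top (x : ℝ) : (2 : ℝ≥0∞) ^ x ≠ ⊤ := by simp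

theorem ofReal_two_rpow (x : ℝ) : ENNReal.ofReal ((2 : ℝ) ^ x) = 2 ^ x := by
  rw [← ENNReal.ofReal_rpow_of_pos two_pos]; simp

theorem decay_le_one {ε : ℝ} (hε : 0 ≤ ε) (k : ℤ) : decay ε k ≤ 1 := by
  rw [decay, ← ENNReal.rpow_zero (x := 2)]
  exact two_rpow_mono (neg_nonpos.2 (mul_nonneg hε (abs_nonneg _)))

theorem tsum_decay_ne_top {ε : ℝ} (hε : 0 < ε) : ∑' k, decay ε k ≠ ⊤ := by
  have hlt : (2 : ℝ≥0∞) ^ (-ε) < 1 :=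
    ENNReal.rpow_lt_one_of_one_lt_of_neg ENNReal.one_lt_two (by linarith)
  have hpos : ∀ n : ℕ, decay ε n = ((2 : ℝ≥0∞) ^ (-ε)) ^ n := fun n => by
    rw [decay, ← ENNReal.rpow_natCast, ← ENNReal.rpow_mul]
    simp
  have hneg : ∀ n : ℕ, decay ε (-(n + 1)) = ((2 : ℝ≥0∞) ^ (-ε)) ^ (n + 1) := fun n => by
    have : ((-((n : ℤ) + 1) : ℤ) : ℝ) = -(((n + 1 : ℕ) : ℤ) : ℝ) := by push_cast; ring
    rw [← hpos, decay, decay, this, abs_neg]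
  rw [tsum_of_nat_of_neg_add_one ENNReal.summable ENNReal.summable]
  simp only [hpos, hneg, pow_succ, ENNReal.tsum_mul_right]
  have := (tsum_geometric_lt_top.2 hlt).ne
  exact ENNReal.add_ne_top.2 ⟨this, ENNReal.mul_ne_top this (two_rpow_ne_top _)⟩

theorem one_le_tsum_decay (ε : ℝ) : 1 ≤ ∑' k, decay ε k := by
  calc (1 : ℝ≥0∞) = decay ε 0 := by simp [decay]
    _ ≤ _ := ENNReal.le_tsum 0

theorem tsum_decay_sub_left (ε : ℝ) (m : ℤ) : ∑' j, decay ε (m - j) = ∑' k, decay ε k :=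
  (Equiv.subLeft m).tsum_eq (decay ε)

theorem tsum_decay_sub_right (ε : ℝ) (j : ℤ) : ∑' m, decay ε (m - j) = ∑' k, decay ε k :=
  (Equiv.subRight j).tsum_eq (decay ε)

/-- Jensen's inequality for weights that need not have total mass one. -/
theorem tsum_mul_rpow_le {ι : Type*} (w f : ι → ℝ≥0∞) {p : ℝ} (hp : 1 ≤ p) :
    (∑' i, w i * f i) ^ p ≤ (∑' i, w i) ^ (p - 1) * ∑' i, w i * f i ^ p := by
  have hp0 : 0 < p := by linarith
  have key : ∑' i, w i * f i ≤ (∑' i, w i) ^ (1 - p⁻¹) * (∑' i, w i * f i ^ p) ^ p⁻¹ := by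
    rw [ENNReal.tsum_eq_iSup_sum]
    refine iSup_le fun s => (ENNReal.inner_le_weight_mul_Lp_of_nonneg s hp w f).trans ?_
    have : p⁻¹ ≤ 1 := inv_le_one_of_one_le₀ hp
    exact mul_le_mul' (ENNReal.rpow_le_rpow (ENNReal.sum_le_tsum s) (by linarith))
      (ENNReal.rpow_le_rpow (ENNReal.sum_le_tsum s) (by positivity))
  calc _ ≤ _ := ENNReal.rpow_le_rpow key hp0.le
    _ = _ := by
      rw [ENNReal.mul_rpow_of_nonneg _ _ hp0.le, ← ENNReal.rpow_mul, ← ENNReal.rpow_mul,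
        inv_mul_cancel₀ hp0.ne', ENNReal.rpow_one, sub_mul, one_mul, inv_mul_cancel₀ hp0.ne']

/-- Convolution with a geometric weight is bounded on `ℓ^{p(·)}(ℤ)` when `p` is constant on each
half-line. Within a half-line this is Jensen's inequality; across the origin the terms `a j ≤ 1`
are controlled by the weight alone, since `|m - j| = |m| + |j|` for `m`, `j` of opposite signs. -/
theorem exists_seqNorm_conv_le {u v ε : ℝ} (hu : 1 ≤ u) (hv : 1 ≤ v) (hε : 0 < ε) :
    ∃ C : ℝ≥0, 0 < C ∧ ∀ a : ℤ → ℝ≥0∞,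
      seqNorm (signExp u v) (fun m => ∑' j, decay ε (m - j) * a j) ≤
        C * seqNorm (signExp u v) a := by
  have hp := one_le_signExp hu hv
  set p := signExp u v with hpdef
  set W := ∑' k, decay ε k with hW
  have hWtop : W ≠ ⊤ := tsum_decay_ne_top hε
  have hW1 : 1 ≤ W := one_le_tsum_decay ε
  have hW0 : W ≠ 0 := (one_pos.trans_le hW1).ne'
  have hmod : ∀ b : ℤ → ℝ≥0∞, seqModular p b ≤ 1 →
      seqModular p (fun m => (∑' j, decay ε (m - j) * b j) / W) ≤ W + W * W := by
    intro b hb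
    have hb1 := le_one_of_seqModular_le_one hp hb
    have hjensen : ∀ m, ((∑' j, decay ε (m - j) * b j) / W) ^ p m ≤
        ∑' j, decay ε (m - j) * b j ^ p m := by
      intro m
      rw [ENNReal.div_rpow_of_nonneg _ _ (by linarith [hp m])]
      refine ENNReal.div_le_of_le_mul ?_
      refine (tsum_mul_rpow_le _ _ (hp m)).trans ?_
      rw [tsum_decay_sub_left, mul_comm]
      gcongr
      linarith
    have hterm : ∀ m j, decay ε (m - j) * b j ^ p m ≤
        decay ε (m - j) * b j ^ p j + decay ε m * decay ε j := by
      intro m j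
      by_cases hs : (m < 0 ↔ j < 0)
      · have : p m = p j := by simp only [hpdef, signExp, hs]
        rw [this]; exact le_self_add
      · refine le_trans ?_ le_add_self
        calc decay ε (m - j) * b j ^ p m ≤ decay ε (m - j) * 1 := by
              gcongr
              exact ENNReal.rpow_le_one (hb1 j) (by linarith [hp m])
          _ = decay ε m * decay ε j := by
              rw [mul_one, decay, decay, decay, ← two_rpow_add]
              congr 1
              have : |((m - j : ℤ) : ℝ)| = |(m : ℝ)| + |(j : ℝ)| := by
                have : |m - j| = |m| + |j| := by
                  rcases abs_cases m with h1 | h1 <;> rcases abs_cases j with h2 | h2 <;>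
                    rcases abs_cases (m - j) with h3 | h3 <;> omega
                exact_mod_cast this
              rw [this]; ring
    calc seqModular p (fun m => (∑' j, decay ε (m - j) * b j) / W)
        ≤ ∑' m, ∑' j, (decay ε (m - j) * b j ^ p j + decay ε m * decay ε j) :=
          ENNReal.tsum_le_tsum fun m => (hjensen m).trans (ENNReal.tsum_le_tsum fun j => hterm m j)
      _ = W * seqModular p b + W * W := by
          simp only [ENNReal.tsum_add]
          congr 1
          · rw [ENNReal.tsum_comm]
            simp only [ENNReal.tsum_mul_right, tsum_decay_sub_right, ENNReal.tsum_mul_left,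
              seqModular, hW]
          · simp only [ENNReal.tsum_mul_right, ENNReal.tsum_mul_left, hW]
      _ ≤ W + W * W := by
          gcongr
          exact mul_le_of_le_one_right' hb
  set M : ℝ≥0∞ := W + W * W with hM
  have hM1 : 1 ≤ M := hW1.trans le_self_add
  have hMtop : M ≠ ⊤ := ENNReal.add_ne_top.2 ⟨hWtop, ENNReal.mul_ne_top hWtop hWtop⟩
  have hWM : W * M ≠ ⊤ := ENNReal.mul_ne_top hWtop hMtop
  have hWM0 : W * M ≠ 0 := mul_ne_zero hW0 (one_pos.trans_le hM1).ne'
  refine ⟨(W * M).toNNReal, ENNReal.toNNReal_pos hWM0 hWM, fun a => ?_⟩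
  refine modNorm_le_mul (ENNReal.toNNReal_pos hWM0 hWM) fun l hl ha => ?_
  rw [ENNReal.coe_toNNReal hWM]
  have e : ∀ m, (∑' j, decay ε (m - j) * a j) / l / (W * M) =
      (∑' j, decay ε (m - j) * (a j / l)) / W / M := by
    intro m
    simp only [div_eq_mul_inv, ENNReal.mul_inv (Or.inl hW0) (Or.inl hWtop), ← mul_assoc,
      ENNReal.tsum_mul_right]
  simp only [e]
  exact seqModular_div_le_one hp hM1 (hmod _ ha)

/-! ### Exponential blocks of the half-line -/

/-- The block `[2 ^ (d k), 2 ^ (d (k + 1)))` of `(0, ∞)`. -/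
def block (d : ℝ) (k : ℤ) : Set ℝ := Ico ((2 : ℝ) ^ (d * k)) ((2 : ℝ) ^ (d * (k + 1)))

theorem haarPos_Ico_eq {x y : ℝ} (hx : 0 < x) :
    haarPos (Ico x y) = ∫⁻ t in Ico x y, ENNReal.ofReal t⁻¹ := by
  rw [haarPos, withDensity_apply _ measurableSet_Ico, Measure.restrict_restrict measurableSet_Ico,
    inter_eq_left.2 (show Ico x y ⊆ Ioi 0 from fun t ht => hx.trans_le ht.1)]

theorem haarPos_Ico_le {x y : ℝ} (hx : 0 < x) :
    haarPos (Ico x y) ≤ ENNReal.ofReal (x⁻¹ * (y - x)) := by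
  rw [haarPos_Ico_eq hx, ENNReal.ofReal_mul (by positivity), ← Real.volume_Ico,
    ← setLIntegral_const]
  refine setLIntegral_mono measurable_const fun t ht => ENNReal.ofReal_le_ofReal ?_
  exact inv_anti₀ hx ht.1

theorem le_haarPos_Ico {x y : ℝ} (hx : 0 < x) (hxy : x < y) :
    ENNReal.ofReal (y⁻¹ * (y - x)) ≤ haarPos (Ico x y) := by
  have hy := hx.trans hxy
  rw [haarPos_Ico_eq hx, ENNReal.ofReal_mul (by positivity), ← Real.volume_Ico,
    ← setLIntegral_const]
  refine setLIntegral_mono' measurableSet_Ico fun t ht => ENNReal.ofReal_le_ofReal ?_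
  exact inv_anti₀ (hx.trans_le ht.1) ht.2.le

theorem haarPos_block_le (d : ℝ) (k : ℤ) : haarPos (block d k) ≤ ENNReal.ofReal (2 ^ d - 1) := by
  refine (haarPos_Ico_le (by positivity)).trans_eq ?_
  rw [mul_add, mul_one, Real.rpow_add two_pos]
  congr 1
  field_simp

theorem le_haarPos_block {d : ℝ} (hd : 0 < d) (k : ℤ) :
    ENNReal.ofReal (1 - 2 ^ (-d)) ≤ haarPos (block d k) := by
  refine le_trans (le_of_eq ?_) (le_haarPos_Ico (by positivity)
    (Real.rpow_lt_rpow_of_exponent_lt one_lt_two (by linarith)))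
  rw [mul_add, mul_one, Real.rpow_add two_pos, Real.rpow_neg two_pos.le]
  congr 1
  field_simp

theorem iUnion_block {d : ℝ} (hd : 0 < d) : ⋃ k, block d k = Ioi 0 := by
  ext t
  simp only [mem_iUnion, mem_Ioi, block, mem_Ico]
  refine ⟨fun ⟨k, hk, _⟩ => lt_of_lt_of_le (by positivity) hk, fun ht => ?_⟩
  refine ⟨⌊Real.logb 2 t / d⌋, ?_, ?_⟩
  · rw [← Real.le_logb_iff_rpow_le one_lt_two ht, mul_comm, ← le_div_iff₀ hd]
    exact Int.floor_le _
  · rw [← Real.logb_lt_iff_lt_rpow one_lt_two ht, mul_comm, ← div_lt_iff₀ hd]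
    exact Int.lt_floor_add_one _

theorem lintegral_haarPos_eq_tsum {d : ℝ} (hd : 0 < d) (F : ℝ → ℝ≥0∞) :
    ∫⁻ t, F t ∂haarPos = ∑' k, ∫⁻ t in block d k, F t ∂haarPos := by
  have hdisj : Pairwise (Function.onFun Disjoint (block d)) := by
    have hmono : Monotone fun k : ℤ => (2 : ℝ) ^ (d * k) := fun i j hij =>
      Real.rpow_le_rpow_of_exponent_le one_le_two
        (mul_le_mul_of_nonneg_left (by exact_mod_cast hij) hd.le)
    have := hmono.pairwise_disjoint_on_Ico_succ
    simp only [Order.succ_eq_add_one, Int.cast_add, Int.cast_one] at this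
    exact this
  have hres : haarPos.restrict (Ioi 0) = haarPos := by
    rw [haarPos, restrict_withDensity measurableSet_Ioi,
      Measure.restrict_restrict measurableSet_Ioi, inter_self]
  rw [← lintegral_iUnion (s := block d) (fun k => measurableSet_Ico) hdisj, iUnion_block hd, hres]

/-! ### Freezing a log-Hölder exponent -/

/-- On `[0, 1]` two exponents whose difference is `O(1 / L)` can be interchanged at the cost of an
error `exp (-L)`: above this threshold the ratio of the powers is bounded, below it the power is
negligible. -/
theorem rpow_le_mul_rpow_add {x : ℝ≥0∞} (hx : x ≤ 1) {u v L c : ℝ} (hu : 1 ≤ u)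
    (hL : 0 ≤ L) (hc : |u - v| * L ≤ c) :
    x ^ u ≤ ENNReal.ofReal (Real.exp c) * (x ^ v + ENNReal.ofReal (Real.exp (-L))) := by
  have hE : 1 ≤ ENNReal.ofReal (Real.exp c) := by
    rw [← ENNReal.ofReal_one]
    exact ENNReal.ofReal_le_ofReal (Real.one_le_exp (le_trans (by positivity) hc))
  lift x to ℝ≥0 using (hx.trans_lt ENNReal.one_lt_top).ne
  rcases le_or_gt (x : ℝ≥0∞) (ENNReal.ofReal (Real.exp (-L))) with h | h
  · calc (x : ℝ≥0∞) ^ u ≤ x := ENNReal.rpow_le_self_of_le_one hx hu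
      _ ≤ 1 * (x ^ v + ENNReal.ofReal (Real.exp (-L))) := by
          rw [one_mul]; exact h.trans le_add_self
      _ ≤ _ := by gcongr
  · have hreal : Real.exp (-L) < x := by
      have := (ENNReal.ofReal_lt_iff_lt_toReal (Real.exp_pos _).le ENNReal.coe_ne_top).1 h
      simpa using this
    have hx0 : 0 < (x : ℝ) := (Real.exp_pos _).trans hreal
    have hxn : x ≠ 0 := by
      intro h0; simp [h0] at hx0
    have hx1 : (x : ℝ) ≤ 1 := by exact_mod_cast hx
    have hpow : (x : ℝ) ^ (u - v) ≤ Real.exp c := by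
      rw [Real.rpow_def_of_pos hx0]
      apply Real.exp_le_exp.2
      have h1 : -L ≤ Real.log x := (Real.le_log_iff_exp_le hx0).2 hreal.le
      have h2 : Real.log x ≤ 0 := Real.log_nonpos hx0.le hx1
      calc Real.log x * (u - v) ≤ |Real.log x * (u - v)| := le_abs_self _
        _ = |u - v| * |Real.log x| := by rw [abs_mul, mul_comm]
        _ ≤ |u - v| * L := by
            gcongr
            rw [abs_of_nonpos h2]; linarith
        _ ≤ c := hc
    have hpow' : (x : ℝ≥0∞) ^ (u - v) ≤ ENNReal.ofReal (Real.exp c) := by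
      rw [← ENNReal.coe_rpow_of_ne_zero hxn, ENNReal.coe_le_iff]
      intro p hp
      have : (p : ℝ) = Real.exp c := by
        have := congrArg ENNReal.toReal hp
        rw [ENNReal.toReal_ofReal (Real.exp_pos _).le] at this
        simpa using this.symm
      rw [← NNReal.coe_le_coe, NNReal.coe_rpow, this]
      exact hpow
    calc (x : ℝ≥0∞) ^ u = x ^ (u - v) * x ^ v := by
          rw [← ENNReal.rpow_add _ _ (by exact_mod_cast hxn) ENNReal.coe_ne_top, sub_add_cancel]
      _ ≤ _ := by
          gcongr
          exact le_self_add

theorem one_le_of_logHolderAtInfty {q : ℝ → ℝ} {qinf : ℝ} (hq : ∀ x, 1 ≤ q x)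
    (h : LogHolderAtInfty q qinf) : 1 ≤ qinf := by
  obtain ⟨c, hc, h⟩ := h
  have hlim : Tendsto (fun x : ℝ => qinf + c / Real.log (Real.exp 1 + x)) atTop (𝓝 (qinf + 0)) := by
    refine tendsto_const_nhds.add (tendsto_const_nhds.div_atTop ?_)
    exact Real.tendsto_log_atTop.comp (tendsto_atTop_add_const_left _ _ tendsto_id)
  rw [add_zero] at hlim
  refine ge_of_tendsto hlim ((eventually_ge_atTop 0).mono fun x hx => ?_)
  have h1 := (abs_le.1 (h x)).2
  rw [abs_of_nonneg hx] at h1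
  linarith [hq x]

/-- On the `k`-th block a log-Hölder exponent differs by `O(1 / |k|)` from its limit value at the
end of the half-line containing the block. -/
theorem exists_abs_sub_signExp_mul_le {q : ℝ → ℝ} {qinf : ℝ} (h0 : LogHolderAtZero q)
    (hinf : LogHolderAtInfty q qinf) {d : ℝ} (hd : 0 < d) :
    ∃ c : ℝ, ∀ k : ℤ, ∀ t ∈ block d k,
      |q t - signExp (q 0) qinf k| * (Real.log 2 * (d * |(k : ℝ)|)) ≤ c := by
  obtain ⟨c₀, hc₀, h0⟩ := h0
  obtain ⟨c₁, hc₁, hinf⟩ := hinf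
  have hl2 : 0 < Real.log 2 := Real.log_pos one_lt_two
  refine ⟨max (c₀ * (1 + d * Real.log 2)) c₁, fun k t ht => ?_⟩
  have ht0 : 0 < t := lt_of_lt_of_le (by positivity) ht.1
  have hlog1 : d * k * Real.log 2 ≤ Real.log t := by
    rw [← Real.log_rpow two_pos]
    exact Real.log_le_log (by positivity) ht.1
  have hlog2 : Real.log t ≤ d * (k + 1) * Real.log 2 := by
    rw [← Real.log_rpow two_pos]
    exact Real.log_le_log ht0 ht.2.le
  unfold signExp
  split_ifs with hk
  · refine le_trans ?_ (le_max_left _ _)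
    have hy : 0 < 1 / |t| := by positivity
    have hL1 : 1 ≤ Real.log (Real.exp 1 + 1 / |t|) := by
      rw [Real.le_log_iff_exp_le (by positivity)]; linarith
    have hL2 : -Real.log t ≤ Real.log (Real.exp 1 + 1 / |t|) := by
      rw [← Real.log_inv]
      refine Real.log_le_log (by positivity) ?_
      rw [abs_of_pos ht0, one_div]; linarith [Real.exp_pos 1]
    have hkneg : |(k : ℝ)| = -k := abs_of_neg (by exact_mod_cast hk)
    have hle : Real.log 2 * (d * |(k : ℝ)|) ≤
        (1 + d * Real.log 2) * Real.log (Real.exp 1 + 1 / |t|) := by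
      rw [hkneg]
      have : d * Real.log 2 * 1 ≤ d * Real.log 2 * Real.log (Real.exp 1 + 1 / |t|) := by gcongr
      nlinarith
    calc _ ≤ c₀ / Real.log (Real.exp 1 + 1 / |t|) *
          ((1 + d * Real.log 2) * Real.log (Real.exp 1 + 1 / |t|)) := by
          gcongr
          exact h0 t
      _ = _ := by
          rw [div_mul_eq_mul_div, div_eq_iff (by linarith)]; ring
  · refine le_trans ?_ (le_max_right _ _)
    have hknn : |(k : ℝ)| = k := abs_of_nonneg (by exact_mod_cast not_lt.1 hk)
    have hL1 : 1 ≤ Real.log (Real.exp 1 + |t|) := by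
      rw [Real.le_log_iff_exp_le (by positivity)]; linarith [abs_nonneg t]
    have hle : Real.log 2 * (d * |(k : ℝ)|) ≤ Real.log (Real.exp 1 + |t|) := by
      rw [hknn]
      calc _ = d * k * Real.log 2 := by ring
        _ ≤ _ := hlog1
        _ ≤ _ := Real.log_le_log ht0 (by rw [abs_of_pos ht0]; linarith [Real.exp_pos 1])
    calc _ ≤ c₁ / Real.log (Real.exp 1 + |t|) * Real.log (Real.exp 1 + |t|) := by
          gcongr
          exact hinf t
      _ = _ := by field_simp

/-- Blockwise comparison of powers with the variable and with the frozen exponent. -/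
theorem exists_rpow_compare {q : ℝ → ℝ} {qinf : ℝ} (hq : ∀ x, 1 ≤ q x) (h0 : LogHolderAtZero q)
    (hinf : LogHolderAtInfty q qinf) {d : ℝ} (hd : 0 < d) :
    ∃ E : ℝ≥0∞, E ≠ ⊤ ∧ ∀ k : ℤ, ∀ t ∈ block d k, ∀ x : ℝ≥0∞, x ≤ 1 →
      x ^ q t ≤ E * (x ^ signExp (q 0) qinf k + decay d k) ∧
      x ^ signExp (q 0) qinf k ≤ E * (x ^ q t + decay d k) := by
  obtain ⟨c, hc⟩ := exists_abs_sub_signExp_mul_le h0 hinf hd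
  refine ⟨ENNReal.ofReal (Real.exp c), ENNReal.ofReal_ne_top, fun k t ht x hx => ?_⟩
  have hL : 0 ≤ Real.log 2 * (d * |(k : ℝ)|) := by
    have := Real.log_pos one_lt_two
    positivity
  have hdec : decay d k = ENNReal.ofReal (Real.exp (-(Real.log 2 * (d * |(k : ℝ)|)))) := by
    rw [decay, ← ofReal_two_rpow, Real.rpow_def_of_pos two_pos]
    congr 2; ring
  have hp := one_le_signExp (hq 0) (one_le_of_logHolderAtInfty hq hinf) k
  rw [hdec]
  exact ⟨rpow_le_mul_rpow_add hx (hq t) hL (hc k t ht),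
    rpow_le_mul_rpow_add hx hp hL (by rw [abs_sub_comm]; exact hc k t ht)⟩

/-! ### Discretization of the interpolation norm -/

/-- Increasing functions with `φ (s t) ≤ s φ t` for `s ≥ 1`, such as `t ↦ K(t, f)`. -/
structure IsQuasiconcave (φ : ℝ → ℝ≥0∞) : Prop where
  mono : Monotone φ
  mul_le : ∀ s : ℝ, 1 ≤ s → ∀ t, φ (s * t) ≤ ENNReal.ofReal s * φ t

theorem isQuasiconcave_KFun {Z : Type*} [AddCommGroup Z] (N₀ N₁ : Z → ℝ≥0∞) (f : Z) :
    IsQuasiconcave fun t => KFun N₀ N₁ t f :=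
  ⟨KFun_mono f, fun _ hs t => KFun_mul_le hs t f⟩

/-- The samples `t ^ (-θ) φ t` at the points `t = 2 ^ (d k)`. -/
noncomputable def samples (d θ : ℝ) (φ : ℝ → ℝ≥0∞) (k : ℤ) : ℝ≥0∞ :=
  2 ^ (-(θ * (d * k))) * φ (2 ^ (d * k))

theorem samples_le_of_mem_block {d θ : ℝ} (hθ : 0 ≤ θ) {φ : ℝ → ℝ≥0∞}
    (hφ : IsQuasiconcave φ) {k : ℤ} {t : ℝ} (ht : t ∈ block d k) :
    samples d θ φ k ≤ 2 ^ (θ * d) * (ENNReal.ofReal (t ^ (-θ)) * φ t) := by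
  have ht0 : 0 < t := lt_of_lt_of_le (by positivity) ht.1
  have h1 : (2 : ℝ≥0∞) ^ (-(θ * (d * (k + 1)))) ≤ ENNReal.ofReal (t ^ (-θ)) := by
    rw [← ofReal_two_rpow]
    refine ENNReal.ofReal_le_ofReal ?_
    calc (2 : ℝ) ^ (-(θ * (d * (k + 1)))) = (2 ^ (d * (k + 1))) ^ (-θ) := by
          rw [← Real.rpow_mul two_pos.le]; congr 1; ring
      _ ≤ _ := Real.rpow_le_rpow_of_nonpos ht0 ht.2.le (by linarith)
  calc samples d θ φ k
      = 2 ^ (θ * d) * (2 ^ (-(θ * (d * (k + 1)))) * φ (2 ^ (d * k))) := by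
        rw [samples, ← mul_assoc (2 ^ (θ * d) : ℝ≥0∞), ← two_rpow_add]; congr 2; ring
    _ ≤ _ := by
        gcongr
        exact hφ.mono ht.1

theorem le_samples_of_mem_block {d θ : ℝ} (hd : 0 < d) (hθ : 0 ≤ θ) {φ : ℝ → ℝ≥0∞}
    (hφ : IsQuasiconcave φ) {k : ℤ} {t : ℝ} (ht : t ∈ block d k) :
    ENNReal.ofReal (t ^ (-θ)) * φ t ≤ 2 ^ d * samples d θ φ k := by
  have h1 : ENNReal.ofReal (t ^ (-θ)) ≤ (2 : ℝ≥0∞) ^ (-(θ * (d * k))) := by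
    rw [← ofReal_two_rpow]
    refine ENNReal.ofReal_le_ofReal ?_
    calc t ^ (-θ) ≤ (2 ^ (d * k)) ^ (-θ) :=
          Real.rpow_le_rpow_of_nonpos (by positivity) ht.1 (by linarith)
      _ = _ := by rw [← Real.rpow_mul two_pos.le]; congr 1; ring
  have h2 : φ t ≤ 2 ^ d * φ (2 ^ (d * k)) := by
    rw [← ofReal_two_rpow]
    refine le_trans (hφ.mono ?_) (hφ.mul_le _ (Real.one_le_rpow one_le_two hd.le) _)
    rw [← Real.rpow_add two_pos]
    refine ht.2.le.trans_eq ?_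
    congr 1; ring
  calc _ ≤ 2 ^ (-(θ * (d * k))) * (2 ^ d * φ (2 ^ (d * k))) := by gcongr
    _ = _ := by rw [samples]; ring

section Discretization

variable {q : ℝ → ℝ} {qinf d θ : ℝ}

/-- Sampling is bounded. A modular at most `1` on a block bounds the sample there by a constant,
after which `exists_rpow_compare` applies. -/
theorem exists_seqNorm_samples_le (hq : IsExponent q) (h0 : LogHolderAtZero q)
    (hinf : LogHolderAtInfty q qinf) (hd : 0 < d) (hθ : 0 ≤ θ) :
    ∃ C : ℝ≥0, 0 < C ∧ ∀ φ, IsQuasiconcave φ →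
      seqNorm (signExp (q 0) qinf) (samples d θ φ) ≤
        C * luxemburgNorm q fun t => ENNReal.ofReal (t ^ (-θ)) * φ t := by
  have hp := one_le_signExp (hq.one_le 0) (one_le_of_logHolderAtInfty hq.one_le hinf)
  set p := signExp (q 0) qinf with hpdef
  obtain ⟨E, hE, hcomp⟩ := exists_rpow_compare hq.one_le h0 hinf hd
  set W := ∑' k, decay d k
  have hW : W ≠ ⊤ := tsum_decay_ne_top hd
  set c₀ := ENNReal.ofReal (1 - 2 ^ (-d)) with hc₀
  set c₁ := ENNReal.ofReal (2 ^ d - 1) with hc₁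
  have hc₀0 : c₀ ≠ 0 := by
    have : (2 : ℝ) ^ (-d) < 1 := Real.rpow_lt_one_of_one_lt_of_neg one_lt_two (by linarith)
    simp only [hc₀, ne_eq, ENNReal.ofReal_eq_zero]; linarith
  have hc₁top : c₁ ≠ ⊤ := ENNReal.ofReal_ne_top
  have hc₀top : c₀ ≠ ⊤ := ENNReal.ofReal_ne_top
  set M₀ := max 1 c₀⁻¹ with hM₀
  have hM₀1 : 1 ≤ M₀ := le_max_left _ _
  have hM₀0 : M₀ ≠ 0 := (one_pos.trans_le hM₀1).ne'
  have hM₀top : M₀ ≠ ⊤ := max_ne_top ENNReal.one_ne_top (ENNReal.inv_ne_top.2 hc₀0)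
  set M₁ := max 1 (c₀⁻¹ * (E * (1 + W * c₁))) with hM₁
  have hM₁1 : 1 ≤ M₁ := le_max_left _ _
  have hM₁0 : M₁ ≠ 0 := (one_pos.trans_le hM₁1).ne'
  have hM₁top : M₁ ≠ ⊤ := max_ne_top ENNReal.one_ne_top <|
    ENNReal.mul_ne_top (ENNReal.inv_ne_top.2 hc₀0) <| ENNReal.mul_ne_top hE <|
      ENNReal.add_ne_top.2 ⟨ENNReal.one_ne_top, ENNReal.mul_ne_top hW hc₁top⟩
  -- `F` stands for `t ^ (-θ) φ t`, and `G` for a minorant that is constant on each block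
  have key : ∀ (F : ℝ → ℝ≥0∞) (G : ℤ → ℝ≥0∞), (∀ k, ∀ t ∈ block d k, G k ≤ F t) →
      modular q F ≤ 1 → seqModular p (fun k => G k / M₀ / M₁) ≤ 1 := by
    intro F G hGF hF
    rw [modular, lintegral_haarPos_eq_tsum hd] at hF
    -- if `G k ≥ 1`, then `G k ^ q t ≥ G k`, so the block alone contributes at least `c₀ * G k`
    have hG : ∀ k, G k ≤ M₀ := by
      intro k
      rcases le_total (G k) 1 with h | h
      · exact h.trans hM₀1
      refine le_trans ?_ (le_max_right _ _)
      rw [ENNReal.le_inv_iff_mul_le]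
      calc G k * c₀ ≤ G k * haarPos (block d k) := by gcongr; exact le_haarPos_block hd k
        _ = ∫⁻ _ in block d k, G k ∂haarPos := (setLIntegral_const _ _).symm
        _ ≤ ∫⁻ t in block d k, F t ^ q t ∂haarPos := by
            refine setLIntegral_mono' measurableSet_Ico fun t ht => ?_
            refine (ENNReal.le_rpow_self_of_one_le h (hq.one_le t)).trans ?_
            exact ENNReal.rpow_le_rpow (hGF k t ht) (by linarith [hq.one_le t])
        _ ≤ 1 := (ENNReal.le_tsum k).trans hF
    have hx1 : ∀ k, G k / M₀ ≤ 1 := fun k => ENNReal.div_le_of_le_mul (by rw [one_mul]; exact hG k)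
    have hblock : ∀ k, c₀ * (G k / M₀) ^ p k ≤
        E * (∫⁻ t in block d k, F t ^ q t ∂haarPos + decay d k * c₁) := by
      intro k
      calc c₀ * (G k / M₀) ^ p k ≤ (G k / M₀) ^ p k * haarPos (block d k) := by
            rw [mul_comm]; gcongr; exact le_haarPos_block hd k
        _ = ∫⁻ _ in block d k, (G k / M₀) ^ p k ∂haarPos := (setLIntegral_const _ _).symm
        _ ≤ ∫⁻ t in block d k, E * (F t ^ q t + decay d k) ∂haarPos := by
            refine setLIntegral_mono' measurableSet_Ico fun t ht => ?_
            refine (hcomp k t ht _ (hx1 k)).2.trans ?_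
            gcongr
            · linarith [hq.one_le t]
            · exact (ENNReal.div_le_of_le_mul (le_mul_of_one_le_right' hM₀1)).trans (hGF k t ht)
        _ = E * (∫⁻ t in block d k, F t ^ q t ∂haarPos + decay d k * haarPos (block d k)) := by
            rw [lintegral_const_mul' _ _ hE, lintegral_add_right _ measurable_const,
              setLIntegral_const]
        _ ≤ _ := by gcongr; exact haarPos_block_le d k
    refine seqModular_div_le_one hp hM₁1 (le_trans ?_ (le_max_right _ _))
    have hsum : c₀ * seqModular p (fun k => G k / M₀) ≤ E * (1 + W * c₁) := by
      calc _ = ∑' k, c₀ * (G k / M₀) ^ p k := by rw [seqModular, ENNReal.tsum_mul_left]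
        _ ≤ ∑' k, E * (∫⁻ t in block d k, F t ^ q t ∂haarPos + decay d k * c₁) :=
            ENNReal.tsum_le_tsum hblock
        _ = E * (∑' k, ∫⁻ t in block d k, F t ^ q t ∂haarPos + W * c₁) := by
            rw [ENNReal.tsum_mul_left, ENNReal.tsum_add, ENNReal.tsum_mul_right]
        _ ≤ _ := by gcongr
    calc seqModular p (fun k => G k / M₀)
        = c₀⁻¹ * (c₀ * seqModular p (fun k => G k / M₀)) := by
          rw [← mul_assoc, ENNReal.inv_mul_cancel hc₀0 hc₀top, one_mul]
      _ ≤ _ := by gcongr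
  set T : ℝ≥0∞ := 2 ^ (θ * d) with hT
  have hT0 : T ≠ 0 := two_rpow_ne_zero _
  have hTtop : T ≠ ⊤ := two_rpow_ne_top _
  have hCtop : T * (M₀ * M₁) ≠ ⊤ := ENNReal.mul_ne_top hTtop (ENNReal.mul_ne_top hM₀top hM₁top)
  have hC0 : T * (M₀ * M₁) ≠ 0 := mul_ne_zero hT0 (mul_ne_zero hM₀0 hM₁0)
  refine ⟨(T * (M₀ * M₁)).toNNReal, ENNReal.toNNReal_pos hC0 hCtop, fun φ hφ => ?_⟩
  refine modNorm_le_mul (ENNReal.toNNReal_pos hC0 hCtop) fun l hl hF => ?_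
  rw [ENNReal.coe_toNNReal hCtop]
  have e : ∀ k, samples d θ φ k / l / (T * (M₀ * M₁)) = samples d θ φ k / l / T / M₀ / M₁ := by
    intro k
    rw [div_eq_mul_inv, ENNReal.mul_inv (Or.inl hT0) (Or.inl hTtop),
      ENNReal.mul_inv (Or.inl hM₀0) (Or.inl hM₀top)]
    simp only [div_eq_mul_inv, mul_assoc]
  simp only [e]
  refine key _ _ (fun k t ht => ?_) hF
  exact div_div_le_div_of_le_mul (samples_le_of_mem_block hθ hφ ht)

/-- The converse of `exists_seqNorm_samples_le`: the samples control the whole function. -/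
theorem exists_luxemburgNorm_le_samples (hq : IsExponent q) (h0 : LogHolderAtZero q)
    (hinf : LogHolderAtInfty q qinf) (hd : 0 < d) (hθ : 0 ≤ θ) :
    ∃ C : ℝ≥0, 0 < C ∧ ∀ φ, IsQuasiconcave φ →
      (luxemburgNorm q fun t => ENNReal.ofReal (t ^ (-θ)) * φ t) ≤
        C * seqNorm (signExp (q 0) qinf) (samples d θ φ) := by
  have hp := one_le_signExp (hq.one_le 0) (one_le_of_logHolderAtInfty hq.one_le hinf)
  set p := signExp (q 0) qinf with hpdef
  obtain ⟨E, hE, hcomp⟩ := exists_rpow_compare hq.one_le h0 hinf hd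
  set W := ∑' k, decay d k
  have hW : W ≠ ⊤ := tsum_decay_ne_top hd
  set c₁ := ENNReal.ofReal (2 ^ d - 1) with hc₁
  have hc₁top : c₁ ≠ ⊤ := ENNReal.ofReal_ne_top
  set M₁ := max 1 (E * (1 + W) * c₁) with hM₁
  have hM₁1 : 1 ≤ M₁ := le_max_left _ _
  have hM₁0 : M₁ ≠ 0 := (one_pos.trans_le hM₁1).ne'
  have hM₁top : M₁ ≠ ⊤ := max_ne_top ENNReal.one_ne_top <|
    ENNReal.mul_ne_top (ENNReal.mul_ne_top hE (ENNReal.add_ne_top.2 ⟨ENNReal.one_ne_top, hW⟩))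
      hc₁top
  have key : ∀ (F : ℝ → ℝ≥0∞) (a : ℤ → ℝ≥0∞), (∀ k, ∀ t ∈ block d k, F t ≤ a k) →
      seqModular p a ≤ 1 → modular q (fun t => F t / M₁) ≤ 1 := by
    intro F a hFa ha
    have ha1 := le_one_of_seqModular_le_one hp ha
    refine modular_div_le_one hq.one_le hM₁1 (le_trans ?_ (le_max_right _ _))
    calc modular q F = ∑' k, ∫⁻ t in block d k, F t ^ q t ∂haarPos :=
          lintegral_haarPos_eq_tsum hd _
      _ ≤ ∑' k, E * (a k ^ p k + decay d k) * c₁ := by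
          refine ENNReal.tsum_le_tsum fun k => ?_
          calc ∫⁻ t in block d k, F t ^ q t ∂haarPos
              ≤ ∫⁻ _ in block d k, E * (a k ^ p k + decay d k) ∂haarPos := by
                refine setLIntegral_mono' measurableSet_Ico fun t ht => ?_
                refine (ENNReal.rpow_le_rpow (hFa k t ht) ?_).trans (hcomp k t ht _ (ha1 k)).1
                linarith [hq.one_le t]
            _ = E * (a k ^ p k + decay d k) * haarPos (block d k) := setLIntegral_const _ _
            _ ≤ _ := by gcongr; exact haarPos_block_le d k
      _ = E * (seqModular p a + W) * c₁ := by
          rw [ENNReal.tsum_mul_right, ENNReal.tsum_mul_left, ENNReal.tsum_add, seqModular]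
      _ ≤ _ := by gcongr
  set T : ℝ≥0∞ := 2 ^ d with hT
  have hT0 : T ≠ 0 := two_rpow_ne_zero _
  have hTtop : T ≠ ⊤ := two_rpow_ne_top _
  have hCtop : T * M₁ ≠ ⊤ := ENNReal.mul_ne_top hTtop hM₁top
  have hC0 : T * M₁ ≠ 0 := mul_ne_zero hT0 hM₁0
  refine ⟨(T * M₁).toNNReal, ENNReal.toNNReal_pos hC0 hCtop, fun φ hφ => ?_⟩
  refine modNorm_le_mul (ENNReal.toNNReal_pos hC0 hCtop) fun l hl hF => ?_
  rw [ENNReal.coe_toNNReal hCtop]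
  have e : ∀ y : ℝ≥0∞, y / l / (T * M₁) = y / l / T / M₁ := by
    intro y
    simp only [div_eq_mul_inv, ENNReal.mul_inv (Or.inl hT0) (Or.inl hTtop), ← mul_assoc]
  simp only [e]
  refine key _ _ (fun k t ht => ?_) hF
  exact div_div_le_div_of_le_mul (le_samples_of_mem_block hd hθ hφ ht)

end Discretization

/-! ### Reiteration for abstract spaces of class `𝒞` -/

/-- The estimate of class `𝒞_J` at the points `t = 2 ^ x`. -/
theorem IsClassJ.exists_forall {Z : Type*} {N₀ N₁ X : Z → ℝ≥0∞} {θ : ℝ}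
    (h : IsClassJ θ N₀ N₁ X) :
    ∃ C : ℝ≥0, ∀ (x : ℝ) (f : Z) (c : ℝ≥0∞), c ≠ ⊤ → N₀ f ≤ c → 2 ^ x * N₁ f ≤ c →
      X f ≤ C * 2 ^ (-(θ * x)) * c := by
  obtain ⟨C, hC⟩ := h
  refine ⟨C, fun x f c hc h0 h1 => ?_⟩
  have h1' : N₁ f < ⊤ := by
    by_contra hcon
    rw [not_lt_top_iff.1 hcon, ENNReal.mul_top (two_rpow_ne_zero x)] at h1
    exact hc (top_le_iff.1 h1)
  have := hC (2 ^ x) (by positivity) f (h0.trans_lt hc.lt_top) h1'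
  rw [← Real.rpow_mul two_pos.le, ofReal_two_rpow, JFun, ofReal_two_rpow,
    show x * -θ = -(θ * x) by ring] at this
  refine this.trans ?_
  gcongr
  exact max_le h0 h1

section Reiteration

variable {Z : Type*} [AddCommGroup Z] {N₀ N₁ X X₀ X₁ : Z → ℝ≥0∞}

/-- At points `t = 2 ^ x` the estimate of class `𝒞_K` holds with a positive constant and without
restriction on `f`. -/
theorem IsClassK.exists_forall {θ : ℝ} (h : IsClassK θ N₀ N₁ X) :
    ∃ C : ℝ≥0, 0 < C ∧ ∀ (x : ℝ) (f : Z), KFun N₀ N₁ (2 ^ x) f ≤ C * 2 ^ (θ * x) * X f := by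
  obtain ⟨C, hC⟩ := h
  refine ⟨C + 1, by positivity, fun x f => ?_⟩
  rcases eq_or_ne (X f) ⊤ with hf | hf
  · rw [hf, ENNReal.mul_top]
    · exact le_top
    · exact mul_ne_zero (by simp) (two_rpow_ne_zero _)
  · have := hC (2 ^ x) (by positivity) f hf.lt_top
    rw [← Real.rpow_mul two_pos.le, ofReal_two_rpow, mul_comm x θ] at this
    refine this.trans ?_
    gcongr
    exact le_self_add

/-- The `K`-functional of `(A₀, A₁)` is controlled by that of two spaces of class `𝒞_K`. -/
theorem exists_KFun_le_KFun (h₀ : IsExtNorm N₀) (h₁ : IsExtNorm N₁) {θ₀ θ₁ : ℝ}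
    (hK₀ : IsClassK θ₀ N₀ N₁ X₀) (hK₁ : IsClassK θ₁ N₀ N₁ X₁) :
    ∃ C : ℝ≥0, 0 < C ∧ ∀ (x : ℝ) (f : Z),
      KFun N₀ N₁ (2 ^ x) f ≤ C * (2 ^ (θ₀ * x) * KFun X₀ X₁ (2 ^ ((θ₁ - θ₀) * x)) f) := by
  obtain ⟨C₀, hC₀, hK₀⟩ := hK₀.exists_forall
  obtain ⟨C₁, hC₁, hK₁⟩ := hK₁.exists_forall
  refine ⟨max C₀ C₁, lt_max_of_lt_left hC₀, fun x f => ?_⟩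
  set T : ℝ≥0∞ := (max C₀ C₁ : ℝ≥0) * 2 ^ (θ₀ * x) with hT
  have hT0 : T ≠ 0 := mul_ne_zero
    (by exact_mod_cast (lt_max_of_lt_left hC₀ : 0 < max C₀ C₁).ne') (two_rpow_ne_zero _)
  have hTtop : T ≠ ⊤ := ENNReal.mul_ne_top ENNReal.coe_ne_top (two_rpow_ne_top _)
  rw [← mul_assoc, ← hT, mul_comm T, ← ENNReal.div_le_iff_le_mul (Or.inl hT0) (Or.inl hTtop)]
  refine le_KFun fun f₀ f₁ hf => ?_
  rw [ENNReal.div_le_iff_le_mul (Or.inl hT0) (Or.inl hTtop), ofReal_two_rpow]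
  calc KFun N₀ N₁ (2 ^ x) f ≤ KFun N₀ N₁ (2 ^ x) f₀ + KFun N₀ N₁ (2 ^ x) f₁ := by
        rw [hf]; exact (isExtNorm_KFun h₀ h₁ _).add_le _ _
    _ ≤ C₀ * 2 ^ (θ₀ * x) * X₀ f₀ + C₁ * 2 ^ (θ₁ * x) * X₁ f₁ :=
        add_le_add (hK₀ x f₀) (hK₁ x f₁)
    _ ≤ (max C₀ C₁ : ℝ≥0) * 2 ^ (θ₀ * x) * X₀ f₀ + (max C₀ C₁ : ℝ≥0) * 2 ^ (θ₁ * x) * X₁ f₁ := by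
        gcongr
        exacts [le_max_left _ _, le_max_right _ _]
    _ = (X₀ f₀ + 2 ^ ((θ₁ - θ₀) * x) * X₁ f₁) * T := by
        rw [show θ₁ * x = (θ₁ - θ₀) * x + θ₀ * x by ring, two_rpow_add, hT]
        ring

theorem tendsto_mul_two_rpow {c : ℝ≥0∞} (hc : c ≠ ⊤) (x : ℝ) {s : ℝ} (hs : s < 0) :
    Tendsto (fun n : ℕ => c * 2 ^ (x + s * n)) atTop (𝓝 0) := by
  have hlt : (2 : ℝ≥0∞) ^ s < 1 := ENNReal.rpow_lt_one_of_one_lt_of_neg ENNReal.one_lt_two hs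
  have e : ∀ n : ℕ, c * (2 : ℝ≥0∞) ^ (x + s * n) = (c * 2 ^ x) * ((2 : ℝ≥0∞) ^ s) ^ n := fun n => by
    rw [two_rpow_add, ← mul_assoc, ENNReal.rpow_mul, ENNReal.rpow_natCast]
  simp only [e]
  have := ENNReal.Tendsto.const_mul (ENNReal.tendsto_pow_atTop_nhds_zero_of_lt_one hlt)
    (Or.inr (ENNReal.mul_ne_top hc (two_rpow_ne_top x)))
  simpa using this

/-- Near-optimal decompositions of `f` at the scales `2 ^ k` and bounds on their increments: the
fundamental lemma of interpolation theory, up to the convergence of `∑ (g (k + 1) - g k)`. -/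
theorem exists_dyadic_decomposition (h₀ : IsExtNorm N₀) (h₁ : IsExtNorm N₁)
    (hsep : ∀ f, KFun N₀ N₁ 1 f = 0 → f = 0) {f : Z}
    (hf : ∀ k : ℤ, KFun N₀ N₁ (2 ^ (k : ℝ)) f ≠ ⊤) :
    ∃ g h : ℤ → Z, (∀ k, f = g k + h k) ∧
      (∀ k, N₀ (g k) ≤ 2 * KFun N₀ N₁ (2 ^ (k : ℝ)) f) ∧
      (∀ k : ℤ, 2 ^ (k : ℝ) * N₁ (h k) ≤ 2 * KFun N₀ N₁ (2 ^ (k : ℝ)) f) ∧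
      (∀ k, N₀ (g (k + 1) - g k) ≤ 6 * KFun N₀ N₁ (2 ^ (k : ℝ)) f) ∧
      (∀ k : ℤ, 2 ^ (k : ℝ) * N₁ (g (k + 1) - g k) ≤ 6 * KFun N₀ N₁ (2 ^ (k : ℝ)) f) := by
  choose g h hgh hle using fun k : ℤ =>
    exists_add_le_two_mul_KFun h₀ h₁ hsep (t := 2 ^ (k : ℝ)) (by positivity) (hf k)
  simp only [ofReal_two_rpow] at hle
  have hg : ∀ k, N₀ (g k) ≤ 2 * KFun N₀ N₁ (2 ^ (k : ℝ)) f := fun k => le_self_add.trans (hle k)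
  have hh : ∀ k : ℤ, 2 ^ (k : ℝ) * N₁ (h k) ≤ 2 * KFun N₀ N₁ (2 ^ (k : ℝ)) f :=
    fun k => le_add_self.trans (hle k)
  have hstep : ∀ k : ℤ, KFun N₀ N₁ (2 ^ ((k + 1 : ℤ) : ℝ)) f ≤ 2 * KFun N₀ N₁ (2 ^ (k : ℝ)) f := by
    intro k
    have := KFun_mul_le (N₀ := N₀) (N₁ := N₁) one_le_two (2 ^ (k : ℝ)) f
    rw [ENNReal.ofReal_ofNat] at this
    refine le_of_eq_of_le ?_ this
    congr 1
    push_cast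
    rw [Real.rpow_add two_pos, Real.rpow_one, mul_comm]
  refine ⟨g, h, hgh, hg, hh, fun k => ?_, fun k => ?_⟩
  · calc N₀ (g (k + 1) - g k) ≤ N₀ (g (k + 1)) + N₀ (g k) := h₀.sub_le _ _
      _ ≤ 2 * (2 * KFun N₀ N₁ (2 ^ (k : ℝ)) f) + 2 * KFun N₀ N₁ (2 ^ (k : ℝ)) f :=
          add_le_add ((hg _).trans (by gcongr; exact hstep k)) (hg k)
      _ = _ := by ring
  · have e : g (k + 1) - g k = h k - h (k + 1) := by
      rw [sub_eq_sub_iff_add_eq_add, add_comm (h k), ← hgh, ← hgh]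
    calc 2 ^ (k : ℝ) * N₁ (g (k + 1) - g k) ≤ 2 ^ (k : ℝ) * (N₁ (h k) + N₁ (h (k + 1))) := by
          rw [e]; gcongr; exact h₁.sub_le _ _
      _ ≤ 2 ^ (k : ℝ) * N₁ (h k) + 2 ^ ((k + 1 : ℤ) : ℝ) * N₁ (h (k + 1)) := by
          rw [mul_add]
          exact add_le_add le_rfl (mul_le_mul' (two_rpow_mono (by push_cast; linarith)) le_rfl)
      _ ≤ 2 * KFun N₀ N₁ (2 ^ (k : ℝ)) f + 2 * (2 * KFun N₀ N₁ (2 ^ (k : ℝ)) f) :=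
          add_le_add (hh k) ((hh _).trans (by gcongr; exact hstep k))
      _ = _ := by ring

/-- The decomposition `f = G m + H m`, with `G m` and `H m` summed from their increments in `X₀` and
in `X₁`, bounds the samples of `K(t, f; X₀, X₁)` by a convolution with a geometric weight. -/
theorem samples_le_tsum_decay (h₀ : IsExtNorm N₀) (h₁ : IsExtNorm N₁)
    (hsep : ∀ f, KFun N₀ N₁ 1 f = 0 → f = 0)
    (hX₀ : IsExtNorm X₀) (hX₁ : IsExtNorm X₁) (hc₀ : IsCompleteFor X₀) (hc₁ : IsCompleteFor X₁)
    (hi₀ : IsIntermediate N₀ N₁ X₀) (hi₁ : IsIntermediate N₀ N₁ X₁)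
    {η d : ℝ} (hd : 0 < d) {f : Z} {G H : ℤ → Z} (hf : ∀ k, f = G k + H k)
    (hG : ∀ m : ℤ, Tendsto (fun n : ℕ => KFun N₀ N₁ 1 (G (m - n))) atTop (𝓝 0))
    (hH : ∀ m : ℤ, Tendsto (fun n : ℕ => KFun N₀ N₁ 1 (H (m + n))) atTop (𝓝 0))
    {c : ℝ≥0∞} {α : ℤ → ℝ≥0∞}
    (hb₀ : ∀ k : ℤ, X₀ (G (k + 1) - G k) ≤ c * 2 ^ (η * (d * k)) * α k)
    (hb₁ : ∀ k : ℤ, X₁ (G (k + 1) - G k) ≤ c * 2 ^ (-((1 - η) * (d * k))) * α k) (m : ℤ) :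
    samples d η (fun t => KFun X₀ X₁ t f) m ≤
      2 * c * ∑' j, decay (d * min η (1 - η)) (m - j) * α j := by
  set ε := d * min η (1 - η) with hε
  have hε₀ : ε ≤ d * η := mul_le_mul_of_nonneg_left (min_le_left _ _) hd.le
  have hε₁ : ε ≤ d * (1 - η) := mul_le_mul_of_nonneg_left (min_le_right _ _) hd.le
  have hGm : 2 ^ (-(η * (d * m))) * X₀ (G m) ≤ c * ∑' j, decay ε (m - j) * α j := by
    have hs := le_tsum_sub_of_complete h₀ h₁ hsep hX₀ hc₀ hi₀.2 (fun n : ℕ => G (m - n)) (hG m)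
    simp only [Nat.cast_zero, sub_zero] at hs
    have hinj : Function.Injective fun n : ℕ => m - n - 1 := fun a b hab => by
      simp only at hab; omega
    calc 2 ^ (-(η * (d * m))) * X₀ (G m)
        ≤ 2 ^ (-(η * (d * m))) * ∑' n : ℕ, X₀ (G (m - n) - G (m - (n + 1 : ℕ))) := by gcongr
      _ = ∑' n : ℕ, 2 ^ (-(η * (d * m))) * X₀ (G (m - n) - G (m - (n + 1 : ℕ))) := by
          rw [ENNReal.tsum_mul_left]
      _ ≤ ∑' n : ℕ, c * (decay ε (m - (m - n - 1)) * α (m - n - 1)) := by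
          refine ENNReal.tsum_le_tsum fun n => ?_
          have := hb₀ (m - n - 1)
          rw [sub_add_cancel] at this
          rw [show m - ((n + 1 : ℕ) : ℤ) = m - n - 1 by push_cast; ring]
          calc _ ≤ 2 ^ (-(η * (d * m))) *
                  (c * 2 ^ (η * (d * (m - n - 1 : ℤ))) * α (m - n - 1)) := by gcongr
            _ = c * (2 ^ (-(η * (d * m)) + η * (d * (m - n - 1 : ℤ))) * α (m - n - 1)) := by
                rw [two_rpow_add]; ring
            _ ≤ _ := by
                rw [decay]
                gcongr
                · exact one_le_two
                rw [show m - (m - (n : ℤ) - 1) = n + 1 by ring]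
                push_cast
                rw [abs_of_nonneg (by positivity : (0 : ℝ) ≤ n + 1)]
                have : (0 : ℝ) ≤ n + 1 := by positivity
                nlinarith
      _ = c * ∑' n : ℕ, (fun j => decay ε (m - j) * α j) (m - n - 1) := ENNReal.tsum_mul_left
      _ ≤ _ := by
          gcongr
          exact ENNReal.tsum_comp_le_tsum_of_injective hinj fun j => decay ε (m - j) * α j
  have hHm : 2 ^ (-(η * (d * m))) * (2 ^ (d * m) * X₁ (H m)) ≤
      c * ∑' j, decay ε (m - j) * α j := by
    have hs := le_tsum_sub_of_complete h₀ h₁ hsep hX₁ hc₁ hi₁.2 (fun n : ℕ => H (m + n)) (hH m)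
    simp only [Nat.cast_zero, add_zero] at hs
    have hinj : Function.Injective fun n : ℕ => m + n := fun a b hab => by
      simp only at hab; omega
    calc 2 ^ (-(η * (d * m))) * (2 ^ (d * m) * X₁ (H m))
        ≤ 2 ^ (-(η * (d * m))) * (2 ^ (d * m) *
            ∑' n : ℕ, X₁ (H (m + n) - H (m + (n + 1 : ℕ)))) := by gcongr
      _ = ∑' n : ℕ, 2 ^ (-(η * (d * m))) * (2 ^ (d * m) *
            X₁ (H (m + n) - H (m + (n + 1 : ℕ)))) := by
          rw [ENNReal.tsum_mul_left, ENNReal.tsum_mul_left]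
      _ ≤ ∑' n : ℕ, c * (decay ε (m - (m + n)) * α (m + n)) := by
          refine ENNReal.tsum_le_tsum fun n => ?_
          have := hb₁ (m + n)
          have e : H (m + n) - H (m + (n + 1 : ℕ)) = G (m + n + 1) - G (m + n) := by
            rw [show m + ((n + 1 : ℕ) : ℤ) = m + n + 1 by push_cast; ring,
              sub_eq_sub_iff_add_eq_add, add_comm, ← hf, ← hf]
          rw [e]
          calc _ ≤ 2 ^ (-(η * (d * m))) * (2 ^ (d * m) *
                  (c * 2 ^ (-((1 - η) * (d * (m + n : ℤ)))) * α (m + n))) := by gcongr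
            _ = c * (2 ^ (-(η * (d * m)) + (d * m + -((1 - η) * (d * (m + n : ℤ))))) *
                  α (m + n)) := by
                rw [two_rpow_add, two_rpow_add]; ring
            _ ≤ _ := by
                rw [decay]
                gcongr
                · exact one_le_two
                rw [show m - (m + (n : ℤ)) = -n by ring]
                push_cast
                rw [abs_neg, abs_of_nonneg (by positivity : (0 : ℝ) ≤ n)]
                have : (0 : ℝ) ≤ n := by positivity
                nlinarith
      _ = c * ∑' n : ℕ, (fun j => decay ε (m - j) * α j) (m + n) := ENNReal.tsum_mul_left
      _ ≤ _ := by
          gcongr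
          exact ENNReal.tsum_comp_le_tsum_of_injective hinj fun j => decay ε (m - j) * α j
  calc samples d η (fun t => KFun X₀ X₁ t f) m
      ≤ 2 ^ (-(η * (d * m))) * (X₀ (G m) + 2 ^ (d * m) * X₁ (H m)) := by
        rw [samples]
        gcongr
        exact (KFun_le _ (hf m)).trans_eq (by rw [ofReal_two_rpow])
    _ ≤ c * ∑' j, decay ε (m - j) * α j + c * ∑' j, decay ε (m - j) * α j := by
        rw [mul_add]; exact add_le_add hGm hHm
    _ = _ := by ring

section

variable {q : ℝ → ℝ} {qinf θ₀ θ₁ η θ : ℝ}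

/-- The inclusion `(X₀, X₁)_{η, q(·)} ⊆ (A₀, A₁)_{θ, q(·)}`. -/
theorem exists_interpNorm_le_interpNorm_of_classK (hq : IsExponent q) (hq0 : LogHolderAtZero q)
    (hqinf : LogHolderAtInfty q qinf) (hne : θ₀ ≠ θ₁) (hord : θ₁ < θ₀ → q 0 = qinf)
    (hη : 0 ≤ η) (hθ : θ = (1 - η) * θ₀ + η * θ₁) (hθ0 : 0 ≤ θ)
    (h₀ : IsExtNorm N₀) (h₁ : IsExtNorm N₁)
    (hK₀ : IsClassK θ₀ N₀ N₁ X₀) (hK₁ : IsClassK θ₁ N₀ N₁ X₁) :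
    ∃ C : ℝ≥0, 0 < C ∧ ∀ f, interpNorm N₀ N₁ θ q f ≤ C * interpNorm X₀ X₁ η q f := by
  have hp := one_le_signExp (hq.one_le 0) (one_le_of_logHolderAtInfty hq.one_le hqinf)
  have hd : 0 < |θ₁ - θ₀| := abs_pos.2 (sub_ne_zero.2 hne.symm)
  obtain ⟨C₁, hC₁, h1⟩ := exists_luxemburgNorm_le_samples hq hq0 hqinf one_pos hθ0
  obtain ⟨C₂, hC₂, h2⟩ := exists_seqNorm_samples_le hq hq0 hqinf hd hη
  obtain ⟨C, hC, hK⟩ := exists_KFun_le_KFun h₀ h₁ hK₀ hK₁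
  have hmid : ∀ f, seqNorm (signExp (q 0) qinf) (samples 1 θ fun t => KFun N₀ N₁ t f) ≤
      C * seqNorm (signExp (q 0) qinf) (samples |θ₁ - θ₀| η fun t => KFun X₀ X₁ t f) := by
    intro f
    rcases lt_or_gt_of_ne hne with hlt | hlt
    · refine seqNorm_le_mul_of_le hp hC fun k => ?_
      rw [samples, samples, abs_of_pos (by linarith), one_mul]
      calc _ ≤ 2 ^ (-(θ * k)) * (C * (2 ^ (θ₀ * k) * KFun X₀ X₁ (2 ^ ((θ₁ - θ₀) * k)) f)) := by
            gcongr; exact hK _ f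
        _ = C * (2 ^ (-(θ * k) + θ₀ * k) * KFun X₀ X₁ (2 ^ ((θ₁ - θ₀) * k)) f) := by
            rw [two_rpow_add]; ring
        _ = _ := by rw [hθ]; congr 3; ring
    -- for `θ₁ < θ₀` the change of variables reverses the half-line
    · rw [← seqNorm_comp_equiv (Equiv.neg ℤ)
        (fun k => by rw [hord hlt]; simp [signExp])
        (samples |θ₁ - θ₀| η fun t => KFun X₀ X₁ t f)]
      refine seqNorm_le_mul_of_le hp hC fun k => ?_
      rw [samples, samples, abs_of_neg (by linarith), one_mul, Equiv.neg_apply]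
      calc _ ≤ 2 ^ (-(θ * k)) * (C * (2 ^ (θ₀ * k) * KFun X₀ X₁ (2 ^ ((θ₁ - θ₀) * k)) f)) := by
            gcongr; exact hK _ f
        _ = C * (2 ^ (-(θ * k) + θ₀ * k) * KFun X₀ X₁ (2 ^ ((θ₁ - θ₀) * k)) f) := by
            rw [two_rpow_add]; ring
        _ = _ := by
            rw [hθ, show -(θ₁ - θ₀) * ((-k : ℤ) : ℝ) = (θ₁ - θ₀) * k by push_cast; ring]
            congr 3; ring
  refine ⟨C₁ * (C * C₂), by positivity, fun f => ?_⟩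
  calc interpNorm N₀ N₁ θ q f ≤ C₁ * _ := h1 _ (isQuasiconcave_KFun N₀ N₁ f)
    _ ≤ C₁ * (C * (C₂ * interpNorm X₀ X₁ η q f)) := by
        gcongr
        refine (hmid f).trans ?_
        gcongr
        exact h2 _ (isQuasiconcave_KFun X₀ X₁ f)
    _ = _ := by push_cast; ring

/-- The inclusion `(A₀, A₁)_{θ, q(·)} ⊆ (X₀, X₁)_{η, q(·)}`, which needs completeness of `X₀` and
`X₁`. -/
theorem exists_interpNorm_le_interpNorm_of_class (hq : IsExponent q) (hq0 : LogHolderAtZero q)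
    (hqinf : LogHolderAtInfty q qinf) (hne : θ₀ ≠ θ₁) (hord : θ₁ < θ₀ → q 0 = qinf)
    (hη : η ∈ Ioo (0 : ℝ) 1) (hθ : θ = (1 - η) * θ₀ + η * θ₁) (hθ01 : θ ∈ Ioo (0 : ℝ) 1)
    (h₀ : IsExtNorm N₀) (h₁ : IsExtNorm N₁) (hsep : ∀ f, KFun N₀ N₁ 1 f = 0 → f = 0)
    (hX₀ : IsExtNorm X₀) (hX₁ : IsExtNorm X₁) (hc₀ : IsCompleteFor X₀) (hc₁ : IsCompleteFor X₁)
    (hcl₀ : IsClass θ₀ N₀ N₁ X₀) (hcl₁ : IsClass θ₁ N₀ N₁ X₁) :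
    ∃ C : ℝ≥0, 0 < C ∧ ∀ f, interpNorm X₀ X₁ η q f ≤ C * interpNorm N₀ N₁ θ q f := by
  have hu := hq.one_le 0
  have hv := one_le_of_logHolderAtInfty hq.one_le hqinf
  have hp := one_le_signExp hu hv
  set d := |θ₁ - θ₀| with hdd
  have hd : 0 < d := abs_pos.2 (sub_ne_zero.2 hne.symm)
  have hε : 0 < d * min η (1 - η) := mul_pos hd (lt_min hη.1 (by linarith [hη.2]))
  obtain ⟨C₁, hC₁, h1⟩ := exists_luxemburgNorm_le_samples hq hq0 hqinf hd hη.1.le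
  obtain ⟨C₂, hC₂, h2⟩ := exists_seqNorm_samples_le hq hq0 hqinf one_pos hθ01.1.le
  obtain ⟨C₃, hC₃, h3⟩ := exists_seqNorm_conv_le hu hv hε
  obtain ⟨J₀, hJ₀⟩ := hcl₀.classJ.exists_forall
  obtain ⟨J₁, hJ₁⟩ := hcl₁.classJ.exists_forall
  -- the factor `2 ^ d` absorbs the index shift in the case `θ₁ < θ₀`
  set c : ℝ≥0∞ := 2 ^ d * (6 * ((J₀ + J₁ + 1 : ℝ≥0) : ℝ≥0∞)) with hc
  have hctop : 2 * c ≠ ⊤ := by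
    refine ENNReal.mul_ne_top ENNReal.ofNat_ne_top (ENNReal.mul_ne_top (two_rpow_ne_top _) ?_)
    exact ENNReal.mul_ne_top ENNReal.ofNat_ne_top ENNReal.coe_ne_top
  have hc0 : 2 * c ≠ 0 := by
    refine mul_ne_zero two_ne_zero (mul_ne_zero (two_rpow_ne_zero _) (mul_ne_zero (by simp) ?_))
    exact_mod_cast (by positivity : (0 : ℝ≥0) < J₀ + J₁ + 1).ne'
  have hCc : 0 < (2 * c).toNNReal := ENNReal.toNNReal_pos hc0 hctop
  have h2d : (1 : ℝ≥0∞) ≤ 2 ^ d := by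
    simpa using two_rpow_mono hd.le
  have hmid : ∀ f, seqNorm (signExp (q 0) qinf) (samples d η fun t => KFun X₀ X₁ t f) ≤
      (2 * c).toNNReal * C₃ *
        seqNorm (signExp (q 0) qinf) (samples 1 θ fun t => KFun N₀ N₁ t f) := by
    intro f
    set a := samples 1 θ fun t => KFun N₀ N₁ t f with ha
    set A := seqNorm (signExp (q 0) qinf) a with hA
    rcases eq_or_ne A ⊤ with htop | htop
    · rw [htop, ENNReal.mul_top]
      · exact le_top
      · exact mul_ne_zero (by exact_mod_cast hCc.ne') (by exact_mod_cast hC₃.ne')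
    have haA : ∀ k, a k ≤ A := le_seqNorm hp a
    have hKa : ∀ k : ℤ, KFun N₀ N₁ (2 ^ (k : ℝ)) f = 2 ^ (θ * k) * a k := by
      intro k
      rw [ha, samples, one_mul, ← mul_assoc, ← two_rpow_add, add_neg_cancel, ENNReal.rpow_zero,
        one_mul]
    have hKtop : ∀ k : ℤ, KFun N₀ N₁ (2 ^ (k : ℝ)) f ≠ ⊤ := fun k => by
      rw [hKa]
      exact ENNReal.mul_ne_top (two_rpow_ne_top _) ((haA k).trans_lt htop.lt_top).ne
    obtain ⟨g, h, hgh, hg, hh, hu₀, hu₁⟩ := exists_dyadic_decomposition h₀ h₁ hsep hKtop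
    have hg0 : ∀ k : ℤ, KFun N₀ N₁ 1 (g k) ≤ 2 * A * 2 ^ (θ * k) := by
      intro k
      calc _ ≤ N₀ (g k) := KFun_le_left h₁ _ _
        _ ≤ 2 * (2 ^ (θ * k) * A) := (hg k).trans (by rw [hKa]; gcongr; exact haA k)
        _ = _ := by ring
    have hh0 : ∀ k : ℤ, KFun N₀ N₁ 1 (h k) ≤ 2 * A * 2 ^ (-((1 - θ) * k)) := by
      intro k
      calc _ ≤ N₁ (h k) := by simpa using KFun_le_right (N₁ := N₁) h₀ 1 (h k)
        _ = 2 ^ (-(k : ℝ)) * (2 ^ (k : ℝ) * N₁ (h k)) := by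
            rw [← mul_assoc, ← two_rpow_add, neg_add_cancel, ENNReal.rpow_zero, one_mul]
        _ ≤ 2 ^ (-(k : ℝ)) * (2 * (2 ^ (θ * k) * A)) := by
            refine mul_le_mul' le_rfl ((hh k).trans ?_)
            rw [hKa]; gcongr; exact haA k
        _ = 2 * A * 2 ^ (-(k : ℝ) + θ * k) := by rw [two_rpow_add]; ring
        _ = _ := by congr 2; ring
    have h2A : 2 * A ≠ ⊤ := ENNReal.mul_ne_top ENNReal.ofNat_ne_top htop
    have hgt : ∀ m : ℤ, Tendsto (fun n : ℕ => KFun N₀ N₁ 1 (g (m - n))) atTop (𝓝 0) := by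
      intro m
      refine tendsto_of_tendsto_of_tendsto_of_le_of_le tendsto_const_nhds
        (tendsto_mul_two_rpow h2A (θ * m) (neg_neg_of_pos hθ01.1)) (fun _ => zero_le) fun n => ?_
      refine (hg0 (m - n)).trans_eq ?_
      congr 2; push_cast; ring
    have hht : ∀ m : ℤ, Tendsto (fun n : ℕ => KFun N₀ N₁ 1 (h (m + n))) atTop (𝓝 0) := by
      intro m
      refine tendsto_of_tendsto_of_tendsto_of_le_of_le tendsto_const_nhds
        (tendsto_mul_two_rpow h2A (-((1 - θ) * m)) (s := -(1 - θ)) (by linarith [hθ01.2]))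
        (fun _ => zero_le) fun n => ?_
      refine (hh0 (m + n)).trans_eq ?_
      congr 2; push_cast; ring
    have hX₀u : ∀ k : ℤ, X₀ (g (k + 1) - g k) ≤
        6 * ((J₀ + J₁ + 1 : ℝ≥0) : ℝ≥0∞) * 2 ^ (η * ((θ₁ - θ₀) * k)) * a k := by
      intro k
      calc _ ≤ J₀ * 2 ^ (-(θ₀ * k)) * (6 * KFun N₀ N₁ (2 ^ (k : ℝ)) f) :=
            hJ₀ k _ _ (ENNReal.mul_ne_top ENNReal.ofNat_ne_top (hKtop k)) (hu₀ k) (hu₁ k)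
        _ = 6 * J₀ * 2 ^ (-(θ₀ * k) + θ * k) * a k := by rw [hKa, two_rpow_add]; ring
        _ ≤ 6 * ((J₀ + J₁ + 1 : ℝ≥0) : ℝ≥0∞) * 2 ^ (-(θ₀ * k) + θ * k) * a k := by
            gcongr
            rw [add_assoc]; exact le_self_add
        _ = _ := by rw [hθ]; congr 3; ring
    have hX₁u : ∀ k : ℤ, X₁ (g (k + 1) - g k) ≤
        6 * ((J₀ + J₁ + 1 : ℝ≥0) : ℝ≥0∞) * 2 ^ (-((1 - η) * ((θ₁ - θ₀) * k))) * a k := by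
      intro k
      calc _ ≤ J₁ * 2 ^ (-(θ₁ * k)) * (6 * KFun N₀ N₁ (2 ^ (k : ℝ)) f) :=
            hJ₁ k _ _ (ENNReal.mul_ne_top ENNReal.ofNat_ne_top (hKtop k)) (hu₀ k) (hu₁ k)
        _ = 6 * J₁ * 2 ^ (-(θ₁ * k) + θ * k) * a k := by rw [hKa, two_rpow_add]; ring
        _ ≤ 6 * ((J₀ + J₁ + 1 : ℝ≥0) : ℝ≥0∞) * 2 ^ (-(θ₁ * k) + θ * k) * a k := by
            gcongr
            rw [add_comm J₀, add_assoc]; exact le_self_add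
        _ = _ := by rw [hθ]; congr 3; ring
    have hconv : ∀ α : ℤ → ℝ≥0∞, (∀ m, samples d η (fun t => KFun X₀ X₁ t f) m ≤
        2 * c * ∑' j, decay (d * min η (1 - η)) (m - j) * α j) →
        seqNorm (signExp (q 0) qinf) (samples d η fun t => KFun X₀ X₁ t f) ≤
          (2 * c).toNNReal * C₃ * seqNorm (signExp (q 0) qinf) α := by
      intro α hα
      rw [mul_assoc]
      refine (seqNorm_le_mul_of_le hp hCc fun m => ?_).trans (mul_le_mul_right (h3 α) _)
      rw [ENNReal.coe_toNNReal hctop]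
      exact hα m
    rcases lt_or_gt_of_ne hne with hlt | hlt
    · have hdδ : d = θ₁ - θ₀ := abs_of_pos (by linarith)
      refine hconv a (samples_le_tsum_decay h₀ h₁ hsep hX₀ hX₁ hc₀ hc₁ hcl₀.intermediate
        hcl₁.intermediate hd hgh hgt hht (fun k => (hX₀u k).trans ?_) fun k => (hX₁u k).trans ?_)
      · rw [← hdδ, hc]; exact mul_le_mul' (mul_le_mul' (le_mul_of_one_le_left' h2d) le_rfl) le_rfl
      · rw [← hdδ, hc]; exact mul_le_mul' (mul_le_mul' (le_mul_of_one_le_left' h2d) le_rfl) le_rfl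
    -- for `θ₁ < θ₀` the two components exchange their roles and the scales are reversed
    · have hdδ : d = -(θ₁ - θ₀) := abs_of_neg (by linarith)
      have hA' : seqNorm (signExp (q 0) qinf) (fun k => a (-1 - k)) = A :=
        seqNorm_comp_equiv (Equiv.subLeft (-1)) (fun k => by rw [hord hlt]; simp [signExp]) a
      rw [← hA']
      have hinc : ∀ k : ℤ, h (-(k + 1)) - h (-k) = g (-1 - k + 1) - g (-1 - k) := by
        intro k
        rw [show -1 - k + 1 = -k by ring, show -(k + 1) = -1 - k by ring,
          sub_eq_sub_iff_add_eq_add, add_comm, ← hgh, ← hgh]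
      refine hconv _ (samples_le_tsum_decay h₀ h₁ hsep hX₀ hX₁ hc₀ hc₁ hcl₀.intermediate
        hcl₁.intermediate hd (G := fun k => h (-k)) (H := fun k => g (-k))
        (fun k => by rw [add_comm]; exact hgh _) (fun m => ?_) (fun m => ?_) (fun k => ?_)
        fun k => ?_)
      · simpa [neg_sub, sub_eq_add_neg, add_comm] using hht (-m)
      · simpa [sub_eq_add_neg, add_comm] using hgt (-m)
      · simp only [hinc]
        refine (hX₀u _).trans ?_
        calc _ = 6 * ((J₀ + J₁ + 1 : ℝ≥0) : ℝ≥0∞) * 2 ^ (η * d + η * (d * k)) * a (-1 - k) := by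
              rw [show θ₁ - θ₀ = -d by linarith]
              congr 3; push_cast; ring
          _ ≤ 6 * ((J₀ + J₁ + 1 : ℝ≥0) : ℝ≥0∞) * 2 ^ (d + η * (d * k)) * a (-1 - k) := by
              gcongr
              · exact one_le_two
              · nlinarith [hη.2]
          _ = _ := by rw [two_rpow_add, hc]; ring
      · simp only [hinc]
        refine (hX₁u _).trans ?_
        calc _ = 6 * ((J₀ + J₁ + 1 : ℝ≥0) : ℝ≥0∞) *
              2 ^ (-((1 - η) * d) + -((1 - η) * (d * k))) * a (-1 - k) := by
              rw [show θ₁ - θ₀ = -d by linarith]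
              congr 3; push_cast; ring
          _ ≤ 6 * ((J₀ + J₁ + 1 : ℝ≥0) : ℝ≥0∞) * 2 ^ (d + -((1 - η) * (d * k))) *
              a (-1 - k) := by
              gcongr
              · exact one_le_two
              · nlinarith [hη.2]
          _ = _ := by rw [two_rpow_add, hc]; ring
  refine ⟨C₁ * ((2 * c).toNNReal * C₃ * C₂), by positivity, fun f => ?_⟩
  calc interpNorm X₀ X₁ η q f ≤ C₁ * _ := h1 _ (isQuasiconcave_KFun X₀ X₁ f)
    _ ≤ C₁ * ((2 * c).toNNReal * C₃ * (C₂ * interpNorm N₀ N₁ θ q f)) := by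
        gcongr
        refine (hmid f).trans ?_
        gcongr
        exact h2 _ (isQuasiconcave_KFun N₀ N₁ f)
    _ = _ := by push_cast; ring

end

end Reiteration

/-! ### The spaces `(A₀, A₁)_{θ, q(·)}` are of class `𝒞(θ; A₀, A₁)` -/

/-- The Luxemburg norm is subadditive, by convexity of the modular. -/
theorem luxemburgNorm_add_le {q : ℝ → ℝ} (hq : IsExponent q) {F G : ℝ → ℝ≥0∞}
    (hF : Measurable F) :
    luxemburgNorm q (fun t => F t + G t) ≤ luxemburgNorm q F + luxemburgNorm q G := by
  conv_rhs => simp only [luxemburgNorm, ENNReal.iInf_add, ENNReal.add_iInf]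
  refine le_iInf fun m => le_iInf₂ fun hm hG => le_iInf fun l => le_iInf₂ fun hl hF' => ?_
  have hl0 : (l : ℝ≥0∞) ≠ 0 := by exact_mod_cast hl.ne'
  have hm0 : (m : ℝ≥0∞) ≠ 0 := by exact_mod_cast hm.ne'
  rw [luxemburgNorm_eq_modNorm, ← ENNReal.coe_add]
  refine modNorm_le (add_pos hl hm) ?_
  rw [ENNReal.coe_add]
  set s : ℝ≥0∞ := (l : ℝ≥0∞) + m with hs
  have hs0 : s ≠ 0 := by simp [hs, hl0]
  have hsfin : s ≠ ⊤ := by simp [hs]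
  have hw : (l : ℝ≥0∞) / s + m / s = 1 := by
    rw [← ENNReal.add_div, ENNReal.div_self hs0 hsfin]
  have e : ∀ (y : ℝ≥0∞) (r : ℝ≥0), (r : ℝ≥0∞) ≠ 0 → y / s = r / s * (y / r) := by
    intro y r hr
    calc y / s = y * s⁻¹ * (r * (r : ℝ≥0∞)⁻¹) := by
          rw [ENNReal.mul_inv_cancel hr ENNReal.coe_ne_top, mul_one, div_eq_mul_inv]
      _ = _ := by simp only [div_eq_mul_inv]; ring
  calc modular q (fun t => (F t + G t) / s)
      ≤ ∫⁻ t, (l / s * (F t / l) ^ q t + m / s * (G t / m) ^ q t) ∂haarPos := by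
        refine lintegral_mono fun t => ?_
        simp only [ENNReal.add_div]
        rw [e (F t) l hl0, e (G t) m hm0]
        exact ENNReal.rpow_arith_mean_le_arith_mean2_rpow _ _ _ _ hw (hq.one_le t)
    _ = l / s * modular q (fun t => F t / l) + m / s * modular q (fun t => G t / m) := by
        rw [lintegral_add_left (((hF.div_const _).pow hq.measurable).const_mul _),
          lintegral_const_mul' _ _ (ENNReal.div_ne_top ENNReal.coe_ne_top hs0),
          lintegral_const_mul' _ _ (ENNReal.div_ne_top ENNReal.coe_ne_top hs0)]
        rfl
    _ ≤ l / s * 1 + m / s * 1 := by gcongr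
    _ = 1 := by rw [mul_one, mul_one, hw]

theorem modNorm_eq_zero {α : Type*} {ρ : (α → ℝ≥0∞) → ℝ≥0∞} (hρ : ρ (fun _ => 0) ≤ 1) :
    modNorm ρ (fun _ => 0) = 0 := by
  refine le_antisymm (le_of_forall_gt fun c hc => ?_) zero_le
  obtain ⟨l, hl, hlc⟩ := ENNReal.lt_iff_exists_nnreal_btwn.1 hc
  refine lt_of_le_of_lt (modNorm_le (by exact_mod_cast hl) ?_) hlc
  simpa using hρ

section InterpolationSpaces

variable {Z : Type*} [AddCommGroup Z] {N₀ N₁ : Z → ℝ≥0∞} {q : ℝ → ℝ} {qinf θ : ℝ}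

theorem isExtNorm_interpNorm (hq : IsExponent q) (h₀ : IsExtNorm N₀) (h₁ : IsExtNorm N₁) (θ : ℝ) :
    IsExtNorm (interpNorm N₀ N₁ θ q) where
  map_zero := by
    have hz : ∀ t : ℝ, (0 : ℝ≥0∞) ^ q t = 0 := fun t =>
      ENNReal.zero_rpow_of_pos (by linarith [hq.one_le t])
    simp only [interpNorm, (isExtNorm_KFun h₀ h₁ _).map_zero, mul_zero, luxemburgNorm_eq_modNorm]
    exact modNorm_eq_zero (by simp [modular, hz])
  add_le f g := by
    have hmono : ∀ F G : ℝ → ℝ≥0∞, (∀ t, F t ≤ G t) → luxemburgNorm q F ≤ luxemburgNorm q G := by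
      intro F G h
      refine le_modNorm fun l hl hG => modNorm_le hl (le_trans (lintegral_mono fun t => ?_) hG)
      exact ENNReal.rpow_le_rpow (ENNReal.div_le_div_right (h t) _) (by linarith [hq.one_le t])
    have hmeas : Measurable fun t : ℝ => ENNReal.ofReal (t ^ (-θ)) * KFun N₀ N₁ t f :=
      (measurable_id.pow_const _).ennreal_ofReal.mul (KFun_mono f).measurable
    refine (hmono _ _ fun t => ?_).trans (luxemburgNorm_add_le hq hmeas)
    rw [← mul_add]
    gcongr
    exact (isExtNorm_KFun h₀ h₁ t).add_le f g
  map_neg f := by simp only [interpNorm, (isExtNorm_KFun h₀ h₁ _).map_neg]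

theorem isIntermediate_of_classK_of_classJ {X : Z → ℝ≥0∞} (hK : IsClassK θ N₀ N₁ X)
    (hJ : IsClassJ θ N₀ N₁ X) : IsIntermediate N₀ N₁ X := by
  obtain ⟨C, hC⟩ := hK
  obtain ⟨D, hD⟩ := hJ
  refine ⟨⟨D, fun f hf => ?_⟩, C, fun f hf => by simpa using hC 1 one_pos f hf⟩
  rw [JFun, max_lt_iff, ENNReal.ofReal_one, one_mul] at hf
  simpa using hD 1 one_pos f hf.1 hf.2

theorem isClassK_interpNorm (hq : IsExponent q) (hq0 : LogHolderAtZero q)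
    (hqinf : LogHolderAtInfty q qinf) (hθ : 0 ≤ θ) :
    IsClassK θ N₀ N₁ (interpNorm N₀ N₁ θ q) := by
  have hp := one_le_signExp (hq.one_le 0) (one_le_of_logHolderAtInfty hq.one_le hqinf)
  obtain ⟨C, hC, h⟩ := exists_seqNorm_samples_le hq hq0 hqinf one_pos hθ
  refine ⟨2 * C, fun t ht f _ => ?_⟩
  obtain ⟨k, hk⟩ : ∃ k, t ∈ block 1 k := by
    rw [← mem_iUnion, iUnion_block one_pos]; exact ht
  have hφ := isQuasiconcave_KFun N₀ N₁ f
  calc KFun N₀ N₁ t f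
      = ENNReal.ofReal (t ^ θ) * (ENNReal.ofReal (t ^ (-θ)) * KFun N₀ N₁ t f) := by
        rw [← mul_assoc, ← ENNReal.ofReal_mul (by positivity), ← Real.rpow_add ht, add_neg_cancel,
          Real.rpow_zero, ENNReal.ofReal_one, one_mul]
    _ ≤ ENNReal.ofReal (t ^ θ) * (2 ^ (1 : ℝ) * (C * interpNorm N₀ N₁ θ q f)) := by
        refine mul_le_mul' le_rfl ((le_samples_of_mem_block one_pos hθ hφ hk).trans ?_)
        exact mul_le_mul' le_rfl ((le_seqNorm hp _ k).trans (h _ hφ))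
    _ = _ := by rw [ENNReal.rpow_one]; push_cast; ring

/-- A sequence dominated by a summable family bounded by `1` lies in every `ℓ^{p(·)}`. -/
theorem seqNorm_le_mul_tsum {p : ℤ → ℝ} (hp : ∀ k, 1 ≤ p k) {a w : ℤ → ℝ≥0∞} {c : ℝ≥0∞}
    (hw : ∀ k, w k ≤ 1) (hW1 : 1 ≤ ∑' k, w k) (hW : ∑' k, w k ≠ ⊤) (h : ∀ k, a k ≤ c * w k) :
    seqNorm p a ≤ (∑' k, w k) * c := by
  have hW0 : ∑' k, w k ≠ 0 := (one_pos.trans_le hW1).ne'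
  have hw1 : seqModular p (fun k => w k / ∑' k, w k) ≤ 1 := by
    refine seqModular_div_le_one hp hW1 (ENNReal.tsum_le_tsum fun k => ?_)
    exact ENNReal.rpow_le_self_of_le_one (hw k) (hp k)
  rw [mul_comm, ← ENNReal.div_le_iff_le_mul (Or.inl hW0) (Or.inl hW)]
  refine le_of_forall_gt fun b hb => ?_
  obtain ⟨l, hcl, hlb⟩ := ENNReal.lt_iff_exists_nnreal_btwn.1 hb
  refine lt_of_le_of_lt ?_ hlb
  rw [ENNReal.div_le_iff_le_mul (Or.inl hW0) (Or.inl hW)]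
  have hl0 : (l : ℝ≥0∞) ≠ 0 := (zero_le.trans_lt hcl).ne'
  have hlW : (l : ℝ≥0∞) * ∑' k, w k = ((l * (∑' k, w k).toNNReal : ℝ≥0) : ℝ≥0∞) := by
    rw [ENNReal.coe_mul, ENNReal.coe_toNNReal hW]
  rw [hlW]
  have hlpos : 0 < l := by exact_mod_cast pos_of_ne_zero hl0
  refine modNorm_le (mul_pos hlpos (ENNReal.toNNReal_pos hW0 hW)) ?_
  refine (seqModular_mono hp fun k => ?_).trans hw1
  rw [← hlW, div_eq_mul_inv, ENNReal.mul_inv (Or.inl hl0) (Or.inl ENNReal.coe_ne_top), ← mul_assoc,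
    ← div_eq_mul_inv, ← div_eq_mul_inv]
  refine ENNReal.div_le_div_right (ENNReal.div_le_of_le_mul ?_) _
  rw [mul_comm]
  exact (h k).trans (by gcongr)

/-- Since `K(s, f) ≤ min(1, s / t) J(t, f)`, the samples decay geometrically away from `t`. -/
theorem isClassJ_interpNorm (hq : IsExponent q) (hq0 : LogHolderAtZero q)
    (hqinf : LogHolderAtInfty q qinf) (hθ : θ ∈ Ioo (0 : ℝ) 1)
    (h₀ : IsExtNorm N₀) (h₁ : IsExtNorm N₁) :
    IsClassJ θ N₀ N₁ (interpNorm N₀ N₁ θ q) := by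
  have hp := one_le_signExp (hq.one_le 0) (one_le_of_logHolderAtInfty hq.one_le hqinf)
  obtain ⟨C, hC, h⟩ := exists_luxemburgNorm_le_samples hq hq0 hqinf one_pos hθ.1.le
  set ε := min θ (1 - θ) with hε
  have hεpos : 0 < ε := lt_min hθ.1 (by linarith [hθ.2])
  set W := ∑' k, decay ε k with hW
  have hWtop : W ≠ ⊤ := tsum_decay_ne_top hεpos
  refine ⟨C * W.toNNReal * ((2 : ℝ≥0∞) ^ θ).toNNReal, fun t ht f _ _ => ?_⟩
  obtain ⟨m, hm⟩ : ∃ m, t ∈ block 1 m := by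
    rw [← mem_iUnion, iUnion_block one_pos]; exact ht
  have hm1 : (2 : ℝ) ^ (m : ℝ) ≤ t := by simpa using hm.1
  have hm2 : t ≤ (2 : ℝ) ^ ((m : ℝ) + 1) := by simpa using hm.2.le
  set J := JFun N₀ N₁ t f with hJ
  have hK₁ : ∀ k : ℤ, KFun N₀ N₁ (2 ^ (k : ℝ)) f ≤ 2 ^ ((k : ℝ) - m) * J := by
    intro k
    calc _ ≤ 2 ^ (k : ℝ) * N₁ f := by
          simpa only [ofReal_two_rpow] using KFun_le_right (N₁ := N₁) h₀ (2 ^ (k : ℝ)) f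
      _ = 2 ^ ((k : ℝ) - m) * (2 ^ (m : ℝ) * N₁ f) := by
          rw [← mul_assoc, ← two_rpow_add, sub_add_cancel]
      _ ≤ 2 ^ ((k : ℝ) - m) * (ENNReal.ofReal t * N₁ f) := by
          refine mul_le_mul' le_rfl (mul_le_mul' ?_ le_rfl)
          rw [← ofReal_two_rpow]
          exact ENNReal.ofReal_le_ofReal hm1
      _ ≤ _ := mul_le_mul' le_rfl (le_max_right _ _)
  have hK₀ : ∀ k : ℤ, KFun N₀ N₁ (2 ^ (k : ℝ)) f ≤ J := fun k =>
    (KFun_le_left h₁ _ _).trans (le_max_left _ _)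
  have hsamp : ∀ k, samples 1 θ (fun t => KFun N₀ N₁ t f) k ≤
      2 ^ (-(θ * m)) * J * decay ε (k - m) := by
    intro k
    rw [samples, one_mul, decay]
    rcases le_total m k with hmk | hmk
    · have hr : (0 : ℝ) ≤ ((k - m : ℤ) : ℝ) := by exact_mod_cast sub_nonneg.2 hmk
      calc _ ≤ 2 ^ (-(θ * k)) * J := mul_le_mul' le_rfl (hK₀ k)
        _ = 2 ^ (-(θ * m)) * J * 2 ^ (-(θ * ((k - m : ℤ) : ℝ))) := by
            rw [show -(θ * (k : ℝ)) = -(θ * m) + -(θ * ((k - m : ℤ) : ℝ)) by push_cast; ring,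
              two_rpow_add]
            ring
        _ ≤ _ := by
            refine mul_le_mul' le_rfl (two_rpow_mono ?_)
            rw [abs_of_nonneg hr]
            nlinarith [min_le_left θ (1 - θ)]
    · have hr : ((k - m : ℤ) : ℝ) ≤ 0 := by exact_mod_cast sub_nonpos.2 hmk
      calc _ ≤ 2 ^ (-(θ * k)) * (2 ^ ((k : ℝ) - m) * J) := mul_le_mul' le_rfl (hK₁ k)
        _ = 2 ^ (-(θ * m)) * J * 2 ^ ((1 - θ) * ((k - m : ℤ) : ℝ)) := by
            rw [show (2 : ℝ≥0∞) ^ (-(θ * (k : ℝ))) * (2 ^ ((k : ℝ) - m) * J) =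
              2 ^ (-(θ * (k : ℝ)) + ((k : ℝ) - m)) * J by rw [two_rpow_add]; ring,
              show -(θ * (k : ℝ)) + ((k : ℝ) - m) = -(θ * m) + (1 - θ) * ((k - m : ℤ) : ℝ) by
                push_cast; ring, two_rpow_add]
            ring
        _ ≤ _ := by
            refine mul_le_mul' le_rfl (two_rpow_mono ?_)
            rw [abs_of_nonpos hr]
            nlinarith [min_le_right θ (1 - θ)]
  have hWm : ∑' k, decay ε (k - m) = W := tsum_decay_sub_right ε m
  have hseq := seqNorm_le_mul_tsum hp (a := samples 1 θ fun t => KFun N₀ N₁ t f)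
    (w := fun k => decay ε (k - m)) (c := 2 ^ (-(θ * m)) * J)
    (fun k => decay_le_one hεpos.le _)
    (by rw [hWm]; exact one_le_tsum_decay ε) (by rwa [hWm]) hsamp
  rw [hWm] at hseq
  have ht2 : (2 : ℝ≥0∞) ^ (-(θ * m)) ≤ 2 ^ θ * ENNReal.ofReal (t ^ (-θ)) := by
    calc (2 : ℝ≥0∞) ^ (-(θ * m)) = 2 ^ θ * 2 ^ (-(θ * (m + 1))) := by
          rw [← two_rpow_add]; congr 1; ring
      _ ≤ _ := by
          refine mul_le_mul' le_rfl ?_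
          rw [← ofReal_two_rpow]
          refine ENNReal.ofReal_le_ofReal ?_
          calc (2 : ℝ) ^ (-(θ * (m + 1))) = (2 ^ ((m : ℝ) + 1)) ^ (-θ) := by
                rw [← Real.rpow_mul two_pos.le]; congr 1; ring
            _ ≤ _ := Real.rpow_le_rpow_of_nonpos ht hm2 (by linarith [hθ.1])
  calc interpNorm N₀ N₁ θ q f ≤ C * _ := h _ (isQuasiconcave_KFun N₀ N₁ f)
    _ ≤ C * (W * (2 ^ (-(θ * m)) * J)) := mul_le_mul' le_rfl hseq
    _ ≤ C * (W * (2 ^ θ * ENNReal.ofReal (t ^ (-θ)) * J)) :=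
        mul_le_mul' le_rfl (mul_le_mul' le_rfl (mul_le_mul' ht2 le_rfl))
    _ = _ := by
        push_cast
        rw [ENNReal.coe_toNNReal hWtop, ENNReal.coe_toNNReal (two_rpow_ne_top θ)]
        ring

theorem isClass_interpNorm (hq : IsExponent q) (hq0 : LogHolderAtZero q)
    (hqinf : LogHolderAtInfty q qinf) (hθ : θ ∈ Ioo (0 : ℝ) 1)
    (h₀ : IsExtNorm N₀) (h₁ : IsExtNorm N₁) :
    IsClass θ N₀ N₁ (interpNorm N₀ N₁ θ q) :=
  have hK := isClassK_interpNorm hq hq0 hqinf hθ.1.le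
  have hJ := isClassJ_interpNorm hq hq0 hqinf hθ h₀ h₁
  ⟨isIntermediate_of_classK_of_classJ hK hJ, hK, hJ⟩

end InterpolationSpaces

/-! ### The reiteration theorem -/

theorem sameSpace_of_le_of_le {Z : Type*} {N M : Z → ℝ≥0∞} {C D : ℝ≥0} (hD : 0 < D)
    (h : ∀ f, N f ≤ D * M f) (hC : 0 < C) (h' : ∀ f, M f ≤ C * N f) : SameSpace N M := by
  refine ⟨?_, D⁻¹, C, inv_pos.2 hD, hC, fun f _ => ⟨?_, h' f⟩⟩
  · ext f
    exact ⟨fun hf => (h' f).trans_lt (ENNReal.mul_lt_top ENNReal.coe_lt_top hf),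
      fun hf => (h f).trans_lt (ENNReal.mul_lt_top ENNReal.coe_lt_top hf)⟩
  · calc ((D⁻¹ : ℝ≥0) : ℝ≥0∞) * N f ≤ (D⁻¹ : ℝ≥0) * (D * M f) := by gcongr; exact h f
      _ = M f := by
        rw [← mul_assoc, ← ENNReal.coe_mul, inv_mul_cancel₀ hD.ne', ENNReal.coe_one, one_mul]

theorem SameSpace.symm {Z : Type*} {N M : Z → ℝ≥0∞} (h : SameSpace N M) : SameSpace M N := by
  obtain ⟨hset, c, C, hc, hC, hle⟩ := h
  refine ⟨hset.symm, C⁻¹, c⁻¹, inv_pos.2 hC, inv_pos.2 hc, fun f hf => ?_⟩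
  have hf' : N f < ⊤ := by
    have : f ∈ {f | N f < ⊤} := by rw [hset]; exact hf
    exact this
  obtain ⟨h1, h2⟩ := hle f hf'
  constructor
  · calc ((C⁻¹ : ℝ≥0) : ℝ≥0∞) * M f ≤ (C⁻¹ : ℝ≥0) * (C * N f) := by gcongr
      _ = N f := by
        rw [← mul_assoc, ← ENNReal.coe_mul, inv_mul_cancel₀ hC.ne', ENNReal.coe_one, one_mul]
  · calc N f = ((c⁻¹ : ℝ≥0) : ℝ≥0∞) * (c * N f) := by
          rw [← mul_assoc, ← ENNReal.coe_mul, inv_mul_cancel₀ hc.ne', ENNReal.coe_one, one_mul]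
      _ ≤ (c⁻¹ : ℝ≥0) * M f := by gcongr

theorem convexCombo_mem_Ioo {θ₀ θ₁ η : ℝ} (hne : θ₀ ≠ θ₁) (hη : η ∈ Ioo (0 : ℝ) 1)
    (h₀ : θ₀ ∈ Icc (0 : ℝ) 1) (h₁ : θ₁ ∈ Icc (0 : ℝ) 1) :
    (1 - η) * θ₀ + η * θ₁ ∈ Ioo (0 : ℝ) 1 := by
  obtain ⟨ha, hb⟩ := hη
  rcases lt_or_gt_of_ne hne with h | h
  · constructor <;> nlinarith [h₀.1, h₁.1, h₀.2, h₁.2, mul_pos ha (sub_pos.2 h),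
      mul_pos (sub_pos.2 hb) (sub_pos.2 h)]
  · constructor <;> nlinarith [h₀.1, h₁.1, h₀.2, h₁.2, mul_pos ha (sub_pos.2 h),
      mul_pos (sub_pos.2 hb) (sub_pos.2 h)]

/-- Reiteration for two complete extended norms of class `𝒞` on a common additive group. -/
theorem sameSpace_interpNorm_of_class {Z : Type*} [AddCommGroup Z] {N₀ N₁ X₀ X₁ : Z → ℝ≥0∞}
    {q : ℝ → ℝ} {qinf θ₀ θ₁ η θ : ℝ} (hq : IsExponent q) (hq0 : LogHolderAtZero q)
    (hqinf : LogHolderAtInfty q qinf) (hne : θ₀ ≠ θ₁) (hord : θ₁ < θ₀ → q 0 = qinf)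
    (hη : η ∈ Ioo (0 : ℝ) 1) (hθ : θ = (1 - η) * θ₀ + η * θ₁)
    (hθ₀ : θ₀ ∈ Icc (0 : ℝ) 1) (hθ₁ : θ₁ ∈ Icc (0 : ℝ) 1)
    (h₀ : IsExtNorm N₀) (h₁ : IsExtNorm N₁) (hsep : ∀ f, KFun N₀ N₁ 1 f = 0 → f = 0)
    (hX₀ : IsExtNorm X₀) (hX₁ : IsExtNorm X₁) (hc₀ : IsCompleteFor X₀) (hc₁ : IsCompleteFor X₁)
    (hcl₀ : IsClass θ₀ N₀ N₁ X₀) (hcl₁ : IsClass θ₁ N₀ N₁ X₁) :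
    SameSpace (interpNorm N₀ N₁ θ q) (interpNorm X₀ X₁ η q) := by
  have hθ01 : θ ∈ Ioo (0 : ℝ) 1 := hθ ▸ convexCombo_mem_Ioo hne hη hθ₀ hθ₁
  obtain ⟨C, hC, h⟩ := exists_interpNorm_le_interpNorm_of_classK hq hq0 hqinf hne hord hη.1.le hθ
    hθ01.1.le h₀ h₁ hcl₀.classK hcl₁.classK
  obtain ⟨D, hD, h'⟩ := exists_interpNorm_le_interpNorm_of_class hq hq0 hqinf hne hord hη hθ hθ01
    h₀ h₁ hsep hX₀ hX₁ hc₀ hc₁ hcl₀ hcl₁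
  exact sameSpace_of_le_of_le hC h hD h'

end VarInterp

theorem mainTheorem2 {𝕜 : Type*} [RCLike 𝕜]
    {Z : Type*} [AddCommGroup Z] [Module 𝕜 Z] [TopologicalSpace Z] [IsTopologicalAddGroup Z]
    [ContinuousSMul 𝕜 Z] [T2Space Z]
    {A₀ A₁ : Type*} [NormedAddCommGroup A₀] [NormedSpace 𝕜 A₀]
    [NormedAddCommGroup A₁] [NormedSpace 𝕜 A₁]
    (a₀ : A₀ →L[𝕜] Z) (a₁ : A₁ →L[𝕜] Z)
    (ha₀ : Function.Injective a₀) (ha₁ : Function.Injective a₁)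
    (q : ℝ → ℝ) (qinf : ℝ) (hq : VarInterp.IsExponent q)
    (hq_zero : VarInterp.LogHolderAtZero q) (hq_inf : VarInterp.LogHolderAtInfty q qinf)
    (θ₀ θ₁ η θ : ℝ) (hne : θ₀ ≠ θ₁) (hord : θ₁ < θ₀ → q 0 = qinf)
    (hη : η ∈ Set.Ioo (0 : ℝ) 1) (hθ : θ = (1 - η) * θ₀ + η * θ₁) :
    (∀ (X₀ X₁ : Type*) [NormedAddCommGroup X₀] [NormedSpace 𝕜 X₀] [CompleteSpace X₀]
        [NormedAddCommGroup X₁] [NormedSpace 𝕜 X₁] [CompleteSpace X₁]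
        (x₀ : X₀ →L[𝕜] Z) (x₁ : X₁ →L[𝕜] Z),
        Function.Injective x₀ → Function.Injective x₁ →
        θ₀ ∈ Set.Icc (0 : ℝ) 1 → θ₁ ∈ Set.Icc (0 : ℝ) 1 →
        VarInterp.IsClass θ₀ (VarInterp.embNorm a₀) (VarInterp.embNorm a₁)
          (VarInterp.embNorm x₀) →
        VarInterp.IsClass θ₁ (VarInterp.embNorm a₀) (VarInterp.embNorm a₁)
          (VarInterp.embNorm x₁) →
        VarInterp.SameSpace
          (VarInterp.interpNorm (VarInterp.embNorm a₀) (VarInterp.embNorm a₁) θ q)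
          (VarInterp.interpNorm (VarInterp.embNorm x₀) (VarInterp.embNorm x₁) η q)) ∧
    (∀ (q₀ q₁ : ℝ → ℝ) (q₀inf q₁inf : ℝ),
        VarInterp.IsExponent q₀ → VarInterp.LogHolderAtZero q₀ →
        VarInterp.LogHolderAtInfty q₀ q₀inf →
        VarInterp.IsExponent q₁ → VarInterp.LogHolderAtZero q₁ →
        VarInterp.LogHolderAtInfty q₁ q₁inf →
        θ₀ ∈ Set.Ioo (0 : ℝ) 1 → θ₁ ∈ Set.Ioo (0 : ℝ) 1 →
        VarInterp.IsCompleteFor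
          (VarInterp.interpNorm (VarInterp.embNorm a₀) (VarInterp.embNorm a₁) θ₀ q₀) →
        VarInterp.IsCompleteFor
          (VarInterp.interpNorm (VarInterp.embNorm a₀) (VarInterp.embNorm a₁) θ₁ q₁) →
        VarInterp.SameSpace
          (VarInterp.interpNorm
            (VarInterp.interpNorm (VarInterp.embNorm a₀) (VarInterp.embNorm a₁) θ₀ q₀)
            (VarInterp.interpNorm (VarInterp.embNorm a₀) (VarInterp.embNorm a₁) θ₁ q₁) η q)
          (VarInterp.interpNorm (VarInterp.embNorm a₀) (VarInterp.embNorm a₁) θ q)) := by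

  have h₀ := VarInterp.isExtNorm_embNorm a₀
  have h₁ := VarInterp.isExtNorm_embNorm a₁
  have hsep := VarInterp.eq_zero_of_KFun_embNorm a₀ a₁
  refine ⟨?_, ?_⟩
  · intro X₀ X₁ _ _ _ _ _ _ x₀ x₁ hx₀ hx₁ hθ₀ hθ₁ hcl₀ hcl₁
    exact VarInterp.sameSpace_interpNorm_of_class hq hq_zero hq_inf hne hord hη hθ hθ₀ hθ₁ h₀ h₁
      hsep (VarInterp.isExtNorm_embNorm x₀) (VarInterp.isExtNorm_embNorm x₁)
      (VarInterp.isCompleteFor_embNorm x₀ hx₀) (VarInterp.isCompleteFor_embNorm x₁ hx₁) hcl₀ hcl₁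
  · intro q₀ q₁ q₀inf q₁inf hq₀ hq₀_zero hq₀_inf hq₁ hq₁_zero hq₁_inf hθ₀ hθ₁ hc₀ hc₁
    exact (VarInterp.sameSpace_interpNorm_of_class hq hq_zero hq_inf hne hord hη hθ
      (Set.Ioo_subset_Icc_self hθ₀) (Set.Ioo_subset_Icc_self hθ₁) h₀ h₁ hsep
      (VarInterp.isExtNorm_interpNorm hq₀ h₀ h₁ θ₀) (VarInterp.isExtNorm_interpNorm hq₁ h₀ h₁ θ₁)
      hc₀ hc₁ (VarInterp.isClass_interpNorm hq₀ hq₀_zero hq₀_inf hθ₀ h₀ h₁)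
      (VarInterp.isClass_interpNorm hq₁ hq₁_zero hq₁_inf hθ₁ h₀ h₁)).symm
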